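/- Let $\ell\ge 5$ and $m=2\ell$, and let $(s_0,s_1,s_2,s_3)=(2,4,1,3)$, $(t_0,t_1,t_2,t_3)=(1,3,2,4)$. An $(n_k)$ configuration is a set of $n$ points and $n$ lines of a plane such that each of the lines contains exactly $k$ of the points and each of the points lies on exactly $k$ of the lines. The trivial celestial configuration $2\ell\#(2,1;4,3;1,2;3,4)$ is constructed in the Euclidean plane as follows: $(v_0)_i$ is the point of the unit circle at angle $2\pi i/m$; for $j=0,1,2,3$, $(L_j)_i$ is the line through $(v_j)_i$ and $(v_j)_{i+s_j}$; and for $j=0,1,2$, $(v_{j+1})_i$ is the intersection point of $(L_j)_i$ and $(L_j)_{i-t_j}$ (indices $i$ modulo $m$). Thus $(v_j)_i$ has distance $\prod_{a<j}\cos(s_a\pi/m)/\cos(t_a\pi/m)$ from the origin and angle $\sum_{a<j}(s_a-t_a)\pi/m+2\pi i/m$. A diameter is a line through the origin and one of the points $(v_0)_i$; a mid-diameter is a diameter rotated by $\pi/m$ about the origin. Let $\mathcal D_4(\ell)$ be the system, in the extended Euclidean plane $\mathbb E^{2+}$ (the real projective plane), that consists of the points $(v_j)_i$ and the points at infinity of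 all diameters and mid-diameters, and of the lines $(L_j)_i$, all diameters and all mid-diameters. Then: 1. The $(v_j)_i$ and $(L_j)_i$ form a celestial $((8\ell)_4)$ configuration: the points $(v_j)_i$ ($0\le j\le 3$, $i\in\mathbb Z_m$) are distinct, each class $v_j$ is invariant under the rotation by $2\pi/m$ about the origin, which maps $(v_j)_i$ to $(v_j)_{i+1}$, and $(L_j)_i$ contains exactly the points $(v_j)_i$, $(v_j)_{i+s_j}$, $(v_{j+1})_i$, $(v_{j+1})_{i+t_j}$ among them, where $v_4=v_0$. 2. $\mathcal D_4(\ell)$ is a $((10\ell)_5)$ configuration in $\mathbb E^{2+}$. 3. Every projective transformation of $\mathbb E^{2+}$ that maps all points of $\mathcal D_4(\ell)$ to finite points maps $\mathcal D_4(\ell)$ to a $((10\ell)_5)$ configuration in the Euclidean plane $\mathbb E^2$ that has independent pencils of $p=1$ and $q=1$ parallel lines, that is, two non-parallel lines with no common configuration point. 4. There is such a projective transformation for which $p=q=1$ is also the largest possible value: whenever the image has a pencil of $p$ parallel lines and a pencil of $q$ parallel lines in different directions such that no configuration point lies on a line of both, then $p\le 1$ and $q\le 1$. -/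

import Mathlib

open scoped LinearAlgebra.Projectivization

noncomputable section

namespace D4Config

/-- The Euclidean plane. -/
abbrev Plane : Type := EuclideanSpace ℝ (Fin 2)

/-- The extended Euclidean plane: the real projective plane, in homogeneous coordinates
`[x : y : z]`, with `z = 0` as the line at infinity. -/
abbrev ExtPlane : Type := ℙ ℝ (Fin 3 → ℝ)

/-- The finite point `[x : y : 1]` of the extended plane. -/
def toExt (x : Plane) : ExtPlane :=
  Projectivization.mk ℝ ![x 0, x 1, 1] (fun h => by simpa using congrFun h 2)

/-- The points at infinity. -/
def lineAtInfinity : Set ExtPlane := {x | x.rep 2 = 0}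

/-- The projective line that joins two distinct points `a`, `b`. -/
def join (a b : ExtPlane) : Set ExtPlane := {x | x.submodule ≤ a.submodule ⊔ b.submodule}

/-- The set of all lines of the extended plane. -/
def extLines : Set (Set ExtPlane) := {l | ∃ a b, a ≠ b ∧ l = join a b}

/-- The set of all straight lines of the Euclidean plane. -/
def planeLines : Set (Set Plane) :=
  {l | ∃ a b : Plane, a ≠ b ∧ l = (affineSpan ℝ {a, b} : Set Plane)}

/-- `P` and `L` form an `(n_k)` configuration of points and lines, where `lines` is the set of
all lines of the ambient plane: `n` points and `n` lines, every line in `L` passes through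
exactly `k` points of `P`, and every point of `P` lies on exactly `k` lines of `L`. -/
structure IsConfiguration {X : Type} (lines : Set (Set X)) (n k : ℕ)
    (P : Set X) (L : Set (Set X)) : Prop where
  isLine : L ⊆ lines
  card_points : P.encard = n
  card_lines : L.encard = n
  points_on_line : ∀ l ∈ L, {p ∈ P | p ∈ l}.encard = k
  lines_through_point : ∀ p ∈ P, {l ∈ L | p ∈ l}.encard = k

/-- The rotation of the Euclidean plane about the origin by the angle `θ`. -/
def rotate (θ : ℝ) (x : Plane) : Plane :=
  !₂[Real.cos θ * x 0 - Real.sin θ * x 1, Real.sin θ * x 0 + Real.cos θ * x 1]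

/-! ### Celestial configurations

A symbol `m#(s₁,t₁;…;s_h,t_h)` is given by `m` and `s t : Fin h → ℕ`. The point classes
`v j` are indexed by integers that are read modulo `m`; the centre is the origin. -/

section Celestial

variable {h : ℕ}

/-- The line `(L_j)_i` joins the points `(v_j)_i` and `(v_j)_{i + s_j}`. -/
def celestialLine (s : Fin h → ℕ) (v : Fin h → ℤ → Plane) (j : Fin h) (i : ℤ) : Set ExtPlane :=
  join (toExt (v j i)) (toExt (v j (i + s j)))

/-- All the points `(v_j)_i`, in the extended plane. -/
def celestialPoints (v : Fin h → ℤ → Plane) : Set ExtPlane :=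
  {x | ∃ j i, x = toExt (v j i)}

/-- All the lines `(L_j)_i`. -/
def celestialLines (s : Fin h → ℕ) (v : Fin h → ℤ → Plane) : Set (Set ExtPlane) :=
  {l | ∃ j i, l = celestialLine s v j i}

/-- The twist `δ = ½ ∑ (s_j - t_j)`. -/
def twist (s t : Fin h → ℕ) : ℤ := (∑ j, ((s j : ℤ) - t j)) / 2

/-- The points `v` form a celestial 4-configuration with symbol `m#(s₁,t₁;…;s_h,t_h)`: an
`((mh)_4)` configuration with `h` classes of points and lines under the rotations by multiples
of `2π/m`, whose incidences are exactly those of the reduced Levi graph: `(L_j)_i` contains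
`(v_j)_i`, `(v_j)_{i+s_j}`, `(v_{j+1})_i`, `(v_{j+1})_{i+t_j}`, except that the last class of
lines meets the first class of points with all indices shifted by the twist. -/
structure IsCelestial (m : ℕ) (s t : Fin h → ℕ) (v : Fin h → ℤ → Plane) : Prop where
  twist_int : Even (∑ j, ((s j : ℤ) - t j))
  rotate_eq : ∀ j i, v j (i + 1) = rotate (2 * Real.pi / m) (v j i)
  eq_iff : ∀ j j' i i', v j i = v j' i' ↔ j = j' ∧ i ≡ i' [ZMOD m]
  isConfiguration :
    IsConfiguration extLines (m * h) 4 (celestialPoints v) (celestialLines s v)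
  mem_iff : ∀ a k j i, toExt (v a k) ∈ celestialLine s v j i ↔
    (a = j ∧ (k ≡ i [ZMOD m] ∨ k ≡ i + s j [ZMOD m])) ∨
    (a = finRotate h j ∧
      (k ≡ i + (if (j : ℕ) + 1 = h then twist s t else 0) [ZMOD m] ∨
       k ≡ i + t j + (if (j : ℕ) + 1 = h then twist s t else 0) [ZMOD m]))

/-- The standard construction of the points of a celestial configuration. The point `(v_0)_i`
is the vertex at angle `2πi/m` of a regular `m`-gon on the unit circle, and `(v_{j+1})_i` is the
intersection of `(L_j)_i` and `(L_j)_{i - t_j}`. The lines `(L_j)_i` are at distance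
`r_j cos(s_j π/m)` from the origin if `r_j` is the radius of the class `v_j`, so that
`r_{j+1} = r_j cos(s_j π/m) / cos(t_j π/m)`, and the angle of the point increases by
`(s_j - t_j) π/m`. -/
def celestialPoint (m : ℕ) (s t : Fin h → ℕ) (j : Fin h) (i : ℤ) : Plane :=
  let r : ℝ := ∏ a ∈ Finset.Iio j, Real.cos (s a * Real.pi / m) / Real.cos (t a * Real.pi / m)
  let θ : ℝ := (∑ a ∈ Finset.Iio j, ((s a : ℝ) - t a)) * Real.pi / m + 2 * Real.pi * i / m
  !₂[r * Real.cos θ, r * Real.sin θ]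

end Celestial

/-! ### The construction `D₄(ℓ)` -/

/-- The spans `s_j` of the symbol `2ℓ#(2,1;4,3;1,2;3,4)`. -/
def spanS : Fin 4 → ℕ := ![2, 4, 1, 3]

/-- The spans `t_j` of the symbol `2ℓ#(2,1;4,3;1,2;3,4)`. -/
def spanT : Fin 4 → ℕ := ![1, 3, 2, 4]

/-- The points `(v_j)_i` of `2ℓ#(2,1;4,3;1,2;3,4)`. -/
def basePoint (ℓ : ℕ) : Fin 4 → ℤ → Plane := celestialPoint (2 * ℓ) spanS spanT

/-- The diameters: the lines through the centre and a point of the class `v_0`. -/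
def diameters (ℓ : ℕ) : Set (Set ExtPlane) :=
  {l | ∃ i, l = join (toExt 0) (toExt (basePoint ℓ 0 i))}

/-- The mid-diameters: the diameters rotated by `π/m`, where `m = 2ℓ`. -/
def midDiameters (ℓ : ℕ) : Set (Set ExtPlane) :=
  {l | ∃ i, l = join (toExt 0) (toExt (rotate (Real.pi / (2 * ℓ : ℕ)) (basePoint ℓ 0 i)))}

/-- The points of `D₄(ℓ)`: those of the celestial configuration, and the points at infinity in
the directions of the diameters and mid-diameters. -/
def points (ℓ : ℕ) : Set ExtPlane :=
  celestialPoints (basePoint ℓ) ∪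
    {x | x ∈ lineAtInfinity ∧ ∃ l ∈ diameters ℓ ∪ midDiameters ℓ, x ∈ l}

/-- The lines of `D₄(ℓ)`: those of the celestial configuration, the diameters and the
mid-diameters. -/
def lines (ℓ : ℕ) : Set (Set ExtPlane) :=
  celestialLines spanS (basePoint ℓ) ∪ diameters ℓ ∪ midDiameters ℓ

/-! ### Projection into the Euclidean plane, and pencils of parallel lines -/

/-- The projective transformation of the extended plane that is induced by `g`. -/
def transform (g : (Fin 3 → ℝ) ≃ₗ[ℝ] (Fin 3 → ℝ)) : ExtPlane → ExtPlane :=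
  Projectivization.map g.toLinearMap g.injective

/-- The projective transformation maps all points of `P` to finite points. -/
def IsSuitable (g : (Fin 3 → ℝ) ≃ₗ[ℝ] (Fin 3 → ℝ)) (P : Set ExtPlane) : Prop :=
  ∀ x ∈ P, transform g x ∉ lineAtInfinity

/-- The finite part of the image of a set under a projective transformation. -/
def project (g : (Fin 3 → ℝ) ≃ₗ[ℝ] (Fin 3 → ℝ)) (S : Set ExtPlane) : Set Plane :=
  toExt ⁻¹' (transform g '' S)

/-- Two lines are parallel (possibly equal) if they are translates of each other. -/
def Parallel (l l' : Set Plane) : Prop := ∃ w : Plane, l' = (fun x => x + w) '' l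

/-- Among the lines `L` there are a pencil of `p` parallel lines and a pencil of `q` parallel
lines, in different directions, that are independent: they share no configuration point. -/
def HasIndependentPencils (P : Set Plane) (L : Set (Set Plane)) (p q : ℕ) : Prop :=
  ∃ A ⊆ L, ∃ B ⊆ L, A.encard = p ∧ B.encard = q ∧
    (∀ l ∈ A, ∀ l' ∈ A, Parallel l l') ∧ (∀ l ∈ B, ∀ l' ∈ B, Parallel l l') ∧
    (∀ l ∈ A, ∀ l' ∈ B, ¬ Parallel l l') ∧
    (∀ x ∈ P, ∀ l ∈ A, ∀ l' ∈ B, ¬ (x ∈ l ∧ x ∈ l'))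

end D4Config

end

namespace D4Config

/-! Measure angles in units of π/(2ℓ). The class `v_j` then lies on a circle of radius `radius ℓ j`
at the angles `offset j + 2 * i`, and `(L_j)_i` is the line at distance `apothem ℓ j` from the
origin whose normal has angle `offset j + spanS j + 2 * i`. A point at radius r and angle k lies on
the line at distance d with normal angle n iff r cos(k - n) = d, so every incidence is an equation
between cosines.

For the classes `j` and `j + 1` this equation reads cos e = cos s_j or cos e = cos t_j, with two
solutions modulo 2ℓ each. The cycle of classes closes up because the spans s and t are the same
numbers in another order: the product of cosine ratios is 1 and the total rotation is 0. Unwanted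
incidences are excluded by size together with parity (`radius_mul_cosMul_ne_apothem`): the required
cosine lies strictly between two consecutive values of the parity of e, or above all of them.
Product-to-sum formulas reduce these bounds to monotonicity of the cosine.

The 2ℓ central lines and the 2ℓ points at infinity raise every incidence count from 4 to 5. A
central line of a given parity meets exactly two point classes, in two antipodal points each; a
point at infinity lies on lines of exactly two line classes, two from each (`eq_add_two_mul_iff`).

Projective maps preserve incidences, and finiteness of the configuration points keeps distinct lines
distinct. Two central lines meet only at the origin, which is not a configuration point. If the
origin goes to infinity, a line `L_0` and the diameter perpendicular to it serve instead. Finally,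
sending to infinity a line that avoids all configuration points and a chosen intersection point of
each pair of lines leaves no two distinct lines parallel. -/

/-! ### Lines of the extended plane in homogeneous coordinates -/

/-- The projective line with equation `w 0 * x + w 1 * y + w 2 * z = 0`. -/
def lineOf (w : Fin 3 → ℝ) : Set ExtPlane := {x | x.rep ⬝ᵥ w = 0}

theorem mk_mem_lineOf {u : Fin 3 → ℝ} (hu : u ≠ 0) (w : Fin 3 → ℝ) :
    Projectivization.mk ℝ u hu ∈ lineOf w ↔ u ⬝ᵥ w = 0 := by
  obtain ⟨a, ha⟩ := Projectivization.exists_smul_eq_mk_rep ℝ u hu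
  rw [lineOf, Set.mem_ofPred_eq, ← ha, Units.smul_def, smul_dotProduct, smul_eq_mul]
  simp

theorem mk_mem_lineAtInfinity {u : Fin 3 → ℝ} (hu : u ≠ 0) :
    Projectivization.mk ℝ u hu ∈ lineAtInfinity ↔ u 2 = 0 := by
  obtain ⟨a, ha⟩ := Projectivization.exists_smul_eq_mk_rep ℝ u hu
  rw [lineAtInfinity, Set.mem_ofPred_eq, ← ha, Units.smul_def]
  simp

theorem mk_mem_join_mk {x u v : Fin 3 → ℝ} (hx : x ≠ 0) (hu : u ≠ 0) (hv : v ≠ 0) :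
    Projectivization.mk ℝ x hx ∈ join (Projectivization.mk ℝ u hu) (Projectivization.mk ℝ v hv) ↔
      ∃ s t : ℝ, s • u + t • v = x := by
  rw [join, Set.mem_ofPred_eq, Projectivization.submodule_mk, Projectivization.submodule_mk,
    Projectivization.submodule_mk, Submodule.span_singleton_le_iff_mem, ← Submodule.span_union,
    Set.singleton_union, Submodule.mem_span_pair]

theorem left_mem_join (a b : ExtPlane) : a ∈ join a b := by
  rw [join, Set.mem_ofPred_eq]
  exact le_sup_left

/-- A dimension count: two distinct points span a 2-dimensional space, which lies in the kernel of a
nonzero functional on ℝ³, also of dimension 2. -/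
theorem join_eq_lineOf {a b : ExtPlane} (hab : a ≠ b) {w : Fin 3 → ℝ} (hw : w ≠ 0)
    (ha : a ∈ lineOf w) (hb : b ∈ lineOf w) : join a b = lineOf w := by
  set φ : (Fin 3 → ℝ) →ₗ[ℝ] ℝ := (dotProductBilin ℝ ℝ).flip w with hφ
  have happ : ∀ x, φ x = x ⬝ᵥ w := fun x => rfl
  have hsub : ∀ x : ExtPlane, x ∈ lineOf w ↔ x.submodule ≤ LinearMap.ker φ := by
    intro x
    rw [Projectivization.submodule_eq, Submodule.span_singleton_le_iff_mem, LinearMap.mem_ker,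
      happ]
    rfl
  have hφ0 : φ ≠ 0 := by
    intro h
    apply hw
    have : φ w = 0 := by rw [h]; rfl
    rwa [happ, dotProduct_self_eq_zero] at this
  have hker : Module.finrank ℝ (LinearMap.ker φ) = 2 := by
    have h1 := LinearMap.finrank_range_add_finrank_ker φ
    have h2 : LinearMap.range φ = ⊤ := LinearMap.range_eq_top.2 (LinearMap.surjective hφ0)
    rw [h2, finrank_top, Module.finrank_self, Module.finrank_fin_fun] at h1
    omega
  have hle : a.submodule ⊔ b.submodule ≤ LinearMap.ker φ :=
    sup_le ((hsub a).1 ha) ((hsub b).1 hb)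
  have hne : a.submodule ⊓ b.submodule = ⊥ := by
    have h1 : Module.finrank ℝ a.submodule = 1 := a.finrank_submodule
    have h2 : Module.finrank ℝ b.submodule = 1 := b.finrank_submodule
    by_contra hbot
    have hpos : 1 ≤ Module.finrank ℝ (a.submodule ⊓ b.submodule : Submodule ℝ (Fin 3 → ℝ)) := by
      rw [Nat.one_le_iff_ne_zero]
      exact fun h => hbot (Submodule.finrank_eq_zero.1 h)
    have e1 := Submodule.eq_of_le_of_finrank_le
      (inf_le_left : a.submodule ⊓ b.submodule ≤ a.submodule) (by omega)
    have e2 := Submodule.eq_of_le_of_finrank_le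
      (inf_le_right : a.submodule ⊓ b.submodule ≤ b.submodule) (by omega)
    exact hab (Projectivization.submodule_injective (e1.symm.trans e2))
  have hdim := Submodule.finrank_sup_add_finrank_inf_eq a.submodule b.submodule
  rw [hne, finrank_bot, a.finrank_submodule, b.finrank_submodule] at hdim
  have heq := Submodule.eq_of_le_of_finrank_le hle (by omega)
  ext x
  rw [hsub x, ← heq]
  rfl

/-- Used in both dual roles: an equation of the line through two points, and a common point of two
lines. -/
theorem exists_ne_zero_dotProduct_eq_zero (u v : Fin 3 → ℝ) :
    ∃ w : Fin 3 → ℝ, w ≠ 0 ∧ u ⬝ᵥ w = 0 ∧ v ⬝ᵥ w = 0 := by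
  set f : (Fin 3 → ℝ) →ₗ[ℝ] ℝ × ℝ :=
    (dotProductBilin ℝ ℝ u).prod (dotProductBilin ℝ ℝ v)
  have hf : LinearMap.ker f ≠ ⊥ := LinearMap.ker_ne_bot_of_finrank_lt (by simp)
  obtain ⟨w, hw, h0⟩ := Submodule.exists_mem_ne_zero_of_ne_bot hf
  have h := LinearMap.mem_ker.1 hw
  exact ⟨w, h0, congrArg Prod.fst h, congrArg Prod.snd h⟩

theorem exists_eq_lineOf {l : Set ExtPlane} (hl : l ∈ extLines) : ∃ w, w ≠ 0 ∧ l = lineOf w := by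
  obtain ⟨a, b, hab, rfl⟩ := hl
  obtain ⟨w, hw, h1, h2⟩ := exists_ne_zero_dotProduct_eq_zero a.rep b.rep
  exact ⟨w, hw, join_eq_lineOf hab hw h1 h2⟩

theorem eq_join_of_mem {l : Set ExtPlane} (hl : l ∈ extLines) {a b : ExtPlane} (hab : a ≠ b)
    (ha : a ∈ l) (hb : b ∈ l) : l = join a b := by
  obtain ⟨w, hw, rfl⟩ := exists_eq_lineOf hl
  exact (join_eq_lineOf hab hw ha hb).symm

theorem exists_mem_inter {l l' : Set ExtPlane} (hl : l ∈ extLines) (hl' : l' ∈ extLines) :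
    ∃ x, x ∈ l ∧ x ∈ l' := by
  obtain ⟨w, -, rfl⟩ := exists_eq_lineOf hl
  obtain ⟨w', -, rfl⟩ := exists_eq_lineOf hl'
  obtain ⟨u, hu, h1, h2⟩ := exists_ne_zero_dotProduct_eq_zero w w'
  refine ⟨Projectivization.mk ℝ u hu, ?_, ?_⟩
  · rwa [mk_mem_lineOf, dotProduct_comm]
  · rwa [mk_mem_lineOf, dotProduct_comm]

theorem toExt_injective : Function.Injective toExt := by
  intro x y h
  rw [toExt, toExt, Projectivization.mk_eq_mk_iff'] at h
  obtain ⟨a, ha⟩ := h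
  have h2 := congrFun ha 2
  have h0 := congrFun ha 0
  have h1 := congrFun ha 1
  simp at h0 h1 h2
  subst h2
  ext i
  fin_cases i
  · simpa using h0.symm
  · simpa using h1.symm

theorem toExt_mem_lineOf (x : Plane) (w : Fin 3 → ℝ) :
    toExt x ∈ lineOf w ↔ x 0 * w 0 + x 1 * w 1 + w 2 = 0 := by
  rw [toExt, mk_mem_lineOf]
  simp [dotProduct, Fin.sum_univ_three]

theorem toExt_notMem_lineAtInfinity (x : Plane) : toExt x ∉ lineAtInfinity := by
  rw [toExt, mk_mem_lineAtInfinity]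
  simp

theorem exists_toExt_eq {x : ExtPlane} (hx : x ∉ lineAtInfinity) : ∃ y, toExt y = x := by
  induction x using Projectivization.ind with
  | h u hu =>
    rw [mk_mem_lineAtInfinity] at hx
    refine ⟨!₂[u 0 / u 2, u 1 / u 2], ?_⟩
    rw [toExt, Projectivization.mk_eq_mk_iff']
    refine ⟨(u 2)⁻¹, ?_⟩
    ext i
    fin_cases i
    · simp; field_simp
    · simp; field_simp
    · simp [hx]

theorem toExt_mem_join_toExt {a b : Plane} (x : Plane) :
    toExt x ∈ join (toExt a) (toExt b) ↔ x ∈ affineSpan ℝ {a, b} := by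
  rw [toExt, toExt, toExt, mk_mem_join_mk,
    mem_affineSpan_pair_iff_exists_lineMap_eq]
  constructor
  · rintro ⟨s, t, h⟩
    refine ⟨t, ?_⟩
    have h0 := congrFun h 0
    have h1 := congrFun h 1
    have h2 := congrFun h 2
    simp at h0 h1 h2
    obtain rfl : s = 1 - t := by linarith
    ext i
    fin_cases i
    · simp [AffineMap.lineMap_apply]; linarith
    · simp [AffineMap.lineMap_apply]; linarith
  · rintro ⟨t, rfl⟩
    refine ⟨1 - t, t, ?_⟩
    ext i
    fin_cases i
    · simp [AffineMap.lineMap_apply]; ring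
    · simp [AffineMap.lineMap_apply]; ring
    · simp

/-! ### Configurations from incidence tables -/

/-- With injective labellings of points and lines, all counts can be made on the index types. -/
theorem isConfiguration_range {X I J : Type} {lines : Set (Set X)} {n k : ℕ}
    {p : I → X} {l : J → Set X} [Finite I] [Finite J]
    (hl : ∀ j, l j ∈ lines) (hp : Function.Injective p) (hinj : Function.Injective l)
    (hI : Nat.card I = n) (hJ : Nat.card J = n)
    (hIk : ∀ j, {i | p i ∈ l j}.encard = k) (hJk : ∀ i, {j | p i ∈ l j}.encard = k) :
    IsConfiguration lines n k (Set.range p) (Set.range l) where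
  isLine := by rintro _ ⟨j, rfl⟩; exact hl j
  card_points := by
    rw [← Set.image_univ, hp.encard_image, Set.encard_univ, ENat.card_eq_coe_natCard, hI]
  card_lines := by
    rw [← Set.image_univ, hinj.encard_image, Set.encard_univ, ENat.card_eq_coe_natCard, hJ]
  points_on_line := by
    rintro _ ⟨j, rfl⟩
    rw [← hIk j, ← hp.encard_image]
    congr 1
    ext x
    constructor
    · rintro ⟨⟨i, rfl⟩, h⟩
      exact ⟨i, h, rfl⟩
    · rintro ⟨i, h, rfl⟩
      exact ⟨⟨i, rfl⟩, h⟩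
  lines_through_point := by
    rintro _ ⟨i, rfl⟩
    rw [← hJk i, ← hinj.encard_image]
    congr 1
    ext x
    constructor
    · rintro ⟨⟨j, rfl⟩, h⟩
      exact ⟨j, h, rfl⟩
    · rintro ⟨j, h, rfl⟩
      exact ⟨⟨j, rfl⟩, h⟩

theorem encard_setOf_mem_list {I : Type} {L : List I} (h : L.Nodup) :
    {x | x ∈ L}.encard = L.length := by
  classical
  rw [← List.toFinset_card_of_nodup h, ← Set.encard_coe_eq_coe_finsetCard]
  congr 1
  ext x
  simp

/-! ### Projective images of configurations -/

section Transform

variable (g : (Fin 3 → ℝ) ≃ₗ[ℝ] (Fin 3 → ℝ))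

theorem transform_mk {u : Fin 3 → ℝ} (hu : u ≠ 0) :
    transform g (Projectivization.mk ℝ u hu) =
      Projectivization.mk ℝ (g u) (fun h => hu (g.map_eq_zero_iff.1 h)) := rfl

theorem transform_injective : Function.Injective (transform g) :=
  Projectivization.map_injective _ g.injective

theorem transform_image_join (a b : ExtPlane) :
    transform g '' join a b = join (transform g a) (transform g b) := by
  induction a using Projectivization.ind with
  | h u hu =>
  induction b using Projectivization.ind with
  | h v hv =>
  ext x
  induction x using Projectivization.ind with
  | h y hy =>
  rw [transform_mk, transform_mk, mk_mem_join_mk]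
  constructor
  · rintro ⟨z, hz, h⟩
    induction z using Projectivization.ind with
    | h z hz0 =>
    rw [mk_mem_join_mk] at hz
    rw [transform_mk, Projectivization.mk_eq_mk_iff'] at h
    obtain ⟨s, t, rfl⟩ := hz
    obtain ⟨c, hc⟩ := h
    have hc0 : c ≠ 0 := by
      rintro rfl
      rw [zero_smul] at hc
      exact hz0 (g.map_eq_zero_iff.1 hc.symm)
    refine ⟨c⁻¹ * s, c⁻¹ * t, ?_⟩
    rw [mul_smul, mul_smul, ← smul_add, inv_smul_eq_iff₀ hc0, hc]
    simp
  · rintro ⟨s, t, rfl⟩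
    have h0 : s • u + t • v ≠ 0 := by
      intro h
      apply hy
      rw [← map_smul, ← map_smul, ← map_add, h, map_zero]
    refine ⟨Projectivization.mk ℝ (s • u + t • v) h0, ?_, ?_⟩
    · rw [mk_mem_join_mk]
      exact ⟨s, t, rfl⟩
    · rw [transform_mk]
      congr 1
      simp

theorem mem_project {g} {S : Set ExtPlane} {x : Plane} {y : ExtPlane}
    (h : transform g y = toExt x) : x ∈ project g S ↔ y ∈ S := by
  rw [project, Set.mem_preimage, ← h, (transform_injective g).mem_set_image]

theorem encard_project {S : Set ExtPlane} (hS : IsSuitable g S) :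
    (project g S).encard = S.encard := by
  rw [← (transform_injective g).encard_image S, ← toExt_injective.encard_image, project,
    Set.image_preimage_eq_of_subset]
  rintro _ ⟨x, hx, rfl⟩
  exact exists_toExt_eq (hS x hx)

theorem project_join {a b : ExtPlane} {x y : Plane} (hx : transform g a = toExt x)
    (hy : transform g b = toExt y) :
    project g (join a b) = (affineSpan ℝ {x, y} : Set Plane) := by
  ext z
  rw [project, Set.mem_preimage, transform_image_join, hx, hy, toExt_mem_join_toExt]
  rfl

/-- A line of the configuration is determined by its configuration points. Since a suitable map
keeps those finite, the finite part of the image still determines the line. -/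
theorem IsConfiguration.exists_two_points {n k : ℕ} (hk : 2 ≤ k) {P : Set ExtPlane}
    {L : Set (Set ExtPlane)} (h : IsConfiguration extLines n k P L) {l : Set ExtPlane}
    (hl : l ∈ L) : ∃ a ∈ P, ∃ b ∈ P, a ≠ b ∧ a ∈ l ∧ b ∈ l ∧ l = join a b := by
  have h1 : 1 < {p ∈ P | p ∈ l}.encard := by
    rw [h.points_on_line l hl]
    exact_mod_cast hk
  obtain ⟨a, b, ha, hb, hab⟩ := Set.one_lt_encard_iff.1 h1
  exact ⟨a, ha.1, b, hb.1, hab, ha.2, hb.2, eq_join_of_mem (h.isLine hl) hab ha.2 hb.2⟩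

theorem IsConfiguration.project_injOn {n k : ℕ} (hk : 2 ≤ k) {P : Set ExtPlane}
    {L : Set (Set ExtPlane)} (h : IsConfiguration extLines n k P L) (hg : IsSuitable g P) :
    Set.InjOn (project g) L := by
  intro l hl l' hl' heq
  obtain ⟨a, haP, b, hbP, hab, ha, hb, hj⟩ := h.exists_two_points hk hl
  obtain ⟨x, hx⟩ := exists_toExt_eq (hg a haP)
  obtain ⟨y, hy⟩ := exists_toExt_eq (hg b hbP)
  have ha' : a ∈ l' := by rwa [← mem_project hx.symm, ← heq, mem_project hx.symm]
  have hb' : b ∈ l' := by rwa [← mem_project hy.symm, ← heq, mem_project hy.symm]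
  rw [hj, eq_join_of_mem (h.isLine hl') hab ha' hb']

theorem IsConfiguration.project {n k : ℕ} (hk : 2 ≤ k) {P : Set ExtPlane}
    {L : Set (Set ExtPlane)} (h : IsConfiguration extLines n k P L) (hg : IsSuitable g P) :
    IsConfiguration planeLines n k (project g P) (project g '' L) where
  isLine := by
    rintro _ ⟨l, hl, rfl⟩
    obtain ⟨a, haP, b, hbP, hab, ha, hb, hj⟩ := h.exists_two_points hk hl
    obtain ⟨x, hx⟩ := exists_toExt_eq (hg a haP)
    obtain ⟨y, hy⟩ := exists_toExt_eq (hg b hbP)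
    refine ⟨x, y, ?_, ?_⟩
    · rintro rfl
      exact hab (transform_injective g (hx.symm.trans hy))
    · rw [hj, project_join g hx.symm hy.symm]
  card_points := by rw [encard_project g hg, h.card_points]
  card_lines := by rw [(h.project_injOn g hk hg).encard_image, h.card_lines]
  points_on_line := by
    rintro _ ⟨l, hl, rfl⟩
    rw [← h.points_on_line l hl, ← encard_project g (fun x hx => hg x hx.1)]
    congr 1
    ext x
    constructor
    · rintro ⟨⟨p, hp, hpx⟩, hxl⟩
      exact ⟨p, ⟨hp, (mem_project hpx).1 hxl⟩, hpx⟩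
    · rintro ⟨p, hp, hpx⟩
      exact ⟨⟨p, hp.1, hpx⟩, (mem_project hpx).2 hp.2⟩
  lines_through_point := by
    rintro x ⟨p, hp, hpx⟩
    rw [← h.lines_through_point p hp,
      ← ((h.project_injOn g hk hg).mono (Set.sep_subset L _)).encard_image]
    congr 1
    ext l
    constructor
    · rintro ⟨⟨l, hl, rfl⟩, hxl⟩
      exact ⟨l, ⟨hl, (mem_project hpx).1 hxl⟩, rfl⟩
    · rintro ⟨l, hl, rfl⟩
      exact ⟨⟨l, hl.1, rfl⟩, (mem_project hpx).2 hl.2⟩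

/-- Parallel lines with a common point are equal. -/
theorem Parallel.eq_of_mem {l l' : Set Plane} (hl : l ∈ planeLines) (h : Parallel l l')
    {x : Plane} (hx : x ∈ l) (hx' : x ∈ l') : l = l' := by
  obtain ⟨a, b, -, rfl⟩ := hl
  obtain ⟨w, rfl⟩ := h
  obtain ⟨y, hy, rfl⟩ := hx'
  have hw : w ∈ (affineSpan ℝ {a, b}).direction := by
    simpa using AffineSubspace.vsub_mem_direction hx hy
  ext z
  constructor
  · intro hz
    refine ⟨-w + z, AffineSubspace.vadd_mem_of_mem_direction (neg_mem hw) hz, ?_⟩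
    simp
  · rintro ⟨z, hz, rfl⟩
    have := AffineSubspace.vadd_mem_of_mem_direction hw hz
    rwa [vadd_eq_add, add_comm] at this

/-- A common point with finite image lies on both parallel images, which therefore coincide;
`project` is injective on the configuration lines. -/
theorem IsConfiguration.eq_of_parallel {n k : ℕ} (hk : 2 ≤ k) {P : Set ExtPlane}
    {L : Set (Set ExtPlane)} (h : IsConfiguration extLines n k P L) (hg : IsSuitable g P)
    {l l' : Set ExtPlane} (hl : l ∈ L) (hl' : l' ∈ L)
    (hpar : Parallel (D4Config.project g l) (D4Config.project g l'))
    {x : ExtPlane} (hx : x ∈ l) (hx' : x ∈ l') (hfin : transform g x ∉ lineAtInfinity) :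
    l = l' := by
  obtain ⟨y, hy⟩ := exists_toExt_eq hfin
  exact h.project_injOn g hk hg hl hl'
    (hpar.eq_of_mem ((h.project g hk hg).isLine ⟨l, hl, rfl⟩)
      ((mem_project hy.symm).2 hx) ((mem_project hy.symm).2 hx'))

/-- Two lines whose intersection is mapped to a finite point and is not a configuration point. -/
theorem IsConfiguration.hasIndependentPencils {n k : ℕ} (hk : 2 ≤ k) {P : Set ExtPlane}
    {L : Set (Set ExtPlane)} (h : IsConfiguration extLines n k P L) (hg : IsSuitable g P)
    {l l' : Set ExtPlane} (hl : l ∈ L) (hl' : l' ∈ L) (hne : l ≠ l')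
    {x : ExtPlane} (hx : x ∈ l) (hx' : x ∈ l') (hfin : transform g x ∉ lineAtInfinity)
    (hP : ∀ p ∈ P, ¬ (p ∈ l ∧ p ∈ l')) :
    HasIndependentPencils (D4Config.project g P) (D4Config.project g '' L) 1 1 := by
  refine ⟨{D4Config.project g l}, by simpa using ⟨l, hl, rfl⟩, {D4Config.project g l'},
    by simpa using ⟨l', hl', rfl⟩, by simp, by simp, ?_, ?_, ?_, ?_⟩
  · rintro _ rfl _ rfl
    exact ⟨0, by simp⟩
  · rintro _ rfl _ rfl
    exact ⟨0, by simp⟩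
  · rintro _ rfl _ rfl hpar
    exact hne (h.eq_of_parallel g hk hg hl hl' hpar hx hx' hfin)
  · rintro y ⟨p, hp, hpy⟩ _ rfl _ rfl ⟨h1, h2⟩
    exact hP p hp ⟨(mem_project hpy).1 h1, (mem_project hpy).1 h2⟩

end Transform

/-- A projective transformation that maps the line with equation `x + t y + t² z = 0` to
infinity. -/
def shear (t : ℝ) : (Fin 3 → ℝ) ≃ₗ[ℝ] (Fin 3 → ℝ) where
  toFun v := ![v 1, v 2, v 0 + t * v 1 + t ^ 2 * v 2]
  invFun v := ![v 2 - t * v 0 - t ^ 2 * v 1, v 0, v 1]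
  map_add' u v := by
    ext i
    fin_cases i <;> simp
    ring
  map_smul' c v := by
    ext i
    fin_cases i <;> simp
    ring
  left_inv v := by
    ext i
    fin_cases i <;> simp
    ring
  right_inv v := by
    ext i
    fin_cases i <;> simp
    ring

theorem exists_isSuitable {S : Set ExtPlane} (hS : S.Finite) : ∃ g, IsSuitable g S := by
  have hfin : ∀ x : ExtPlane, {t : ℝ | transform (shear t) x ∈ lineAtInfinity}.Finite := by
    intro x
    induction x using Projectivization.ind with
    | h u hu =>
    -- The last coordinate of the image under `shear t`, as a polynomial in t. Its coefficients are
    -- the coordinates of the point, so it is nonzero and only finitely many t are excluded for each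
    -- point.
    let f : Polynomial ℝ := .C (u 0) + .C (u 1) * .X + .C (u 2) * .X ^ 2
    have hf : f ≠ 0 := by
      intro h
      apply hu
      ext i
      fin_cases i
      · simpa [f, Polynomial.coeff_X, Polynomial.coeff_C] using congrArg (Polynomial.coeff · 0) h
      · simpa [f, Polynomial.coeff_X, Polynomial.coeff_C] using congrArg (Polynomial.coeff · 1) h
      · simpa [f, Polynomial.coeff_X, Polynomial.coeff_C] using congrArg (Polynomial.coeff · 2) h
    refine (f.rootSet_finite ℝ).subset ?_
    intro t ht
    rw [Set.mem_ofPred_eq, transform_mk, mk_mem_lineAtInfinity] at ht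
    rw [Polynomial.mem_rootSet]
    refine ⟨hf, ?_⟩
    simp [shear] at ht
    simp [f]
    linarith
  obtain ⟨t, ht⟩ := (hS.biUnion fun x _ => hfin x).infinite_compl.nonempty
  refine ⟨shear t, fun x hx h => ht ?_⟩
  simp only [Set.mem_iUnion]
  exact ⟨x, hx, h⟩

theorem IsConfiguration.exists_suitable_pencils_le_one {n k : ℕ} (hk : 2 ≤ k) {P : Set ExtPlane}
    {L : Set (Set ExtPlane)} (h : IsConfiguration extLines n k P L) :
    ∃ g, IsSuitable g P ∧ ∀ p q : ℕ, HasIndependentPencils (D4Config.project g P)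
      (D4Config.project g '' L) p q → p ≤ 1 ∧ q ≤ 1 := by
  -- `f l l'` is a common point of the two lines; for l = l' it is merely some point of the line,
  -- which does no harm.
  choose! f hf hf' using fun (l : Set ExtPlane) (hl : l ∈ extLines) (l' : Set ExtPlane)
    (hl' : l' ∈ extLines) => exists_mem_inter hl hl'
  have hPfin : P.Finite := Set.finite_of_encard_eq_coe h.card_points
  have hLfin : L.Finite := Set.finite_of_encard_eq_coe h.card_lines
  obtain ⟨g, hg⟩ := exists_isSuitable (hPfin.union (Set.Finite.image2 f hLfin hLfin))
  have hgP : IsSuitable g P := fun x hx => hg x (Or.inl hx)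
  refine ⟨g, hgP, ?_⟩
  have key : ∀ A ⊆ D4Config.project g '' L, (∀ l ∈ A, ∀ l' ∈ A, Parallel l l') →
      A.encard ≤ 1 := by
    intro A hA hpar
    rw [Set.encard_le_one_iff]
    intro a b ha hb
    have hab := hpar a ha b hb
    obtain ⟨l, hl, rfl⟩ := hA ha
    obtain ⟨l', hl', rfl⟩ := hA hb
    rw [h.eq_of_parallel g hk hgP hl hl' hab (hf l (h.isLine hl) l' (h.isLine hl'))
      (hf' l (h.isLine hl) l' (h.isLine hl')) (hg _ (Or.inr ⟨l, hl, l', hl', rfl⟩))]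
  rintro p q ⟨A, hA, B, hB, hp, hq, hAp, hBp, -, -⟩
  have h1 := key A hA hAp
  have h2 := key B hB hBp
  rw [hp] at h1
  rw [hq] at h2
  exact ⟨by exact_mod_cast h1, by exact_mod_cast h2⟩

/-! ### Cosines of multiples of `π / m` -/

/-- The cosine of `k π / (2ℓ)`. -/
noncomputable def cosMul (ℓ : ℕ) (k : ℤ) : ℝ := Real.cos (k * (Real.pi / (2 * ℓ : ℕ)))

/-- The sine of `k π / (2ℓ)`. -/
noncomputable def sinMul (ℓ : ℕ) (k : ℤ) : ℝ := Real.sin (k * (Real.pi / (2 * ℓ : ℕ)))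

section Trig

variable {ℓ : ℕ}

@[simp] theorem cosMul_zero : cosMul ℓ 0 = 1 := by simp [cosMul]

theorem cosMul_sub (k n : ℤ) :
    cosMul ℓ (k - n) = cosMul ℓ k * cosMul ℓ n + sinMul ℓ k * sinMul ℓ n := by
  simp only [cosMul, sinMul, Int.cast_sub, sub_mul, Real.cos_sub]

theorem sinMul_sub (k n : ℤ) :
    sinMul ℓ (k - n) = sinMul ℓ k * cosMul ℓ n - cosMul ℓ k * sinMul ℓ n := by
  simp only [cosMul, sinMul, Int.cast_sub, sub_mul, Real.sin_sub]

theorem cosMul_sq_add_sinMul_sq (k : ℤ) : cosMul ℓ k ^ 2 + sinMul ℓ k ^ 2 = 1 :=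
  Real.cos_sq_add_sin_sq _

theorem two_mul_cosMul_mul_cosMul (p q : ℤ) :
    2 * (cosMul ℓ p * cosMul ℓ q) = cosMul ℓ (p + q) + cosMul ℓ (p - q) := by
  simp only [cosMul, Int.cast_sub, Int.cast_add, sub_mul, add_mul, Real.cos_sub, Real.cos_add]
  ring

/-- The modulus is 4ℓ because 4ℓ units of π/(2ℓ) make a full turn. It is even, so the parity of the
index is meaningful. -/
theorem cosMul_eq_iff (hℓ : 0 < ℓ) (e k : ℤ) :
    cosMul ℓ e = cosMul ℓ k ↔ e ≡ k [ZMOD (4 * ℓ : ℕ)] ∨ e ≡ -k [ZMOD (4 * ℓ : ℕ)] := by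
  have hpi := Real.pi_ne_zero
  have hl : (ℓ : ℝ) ≠ 0 := by exact_mod_cast hℓ.ne'
  rw [cosMul, cosMul, Real.cos_eq_cos_iff]
  have e1 : ∀ c : ℤ, (k : ℝ) * (Real.pi / (2 * ℓ : ℕ)) =
      2 * c * Real.pi + e * (Real.pi / (2 * ℓ : ℕ)) ↔ k = (4 * ℓ : ℕ) * c + e := by
    intro c
    rw [← @Int.cast_inj ℝ]
    push_cast
    field_simp
    constructor <;> intro h <;> linarith
  have e2 : ∀ c : ℤ, (k : ℝ) * (Real.pi / (2 * ℓ : ℕ)) =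
      2 * c * Real.pi - e * (Real.pi / (2 * ℓ : ℕ)) ↔ k = (4 * ℓ : ℕ) * c - e := by
    intro c
    rw [← @Int.cast_inj ℝ]
    push_cast
    field_simp
    constructor <;> intro h <;> linarith
  simp only [e1, e2, exists_or, Int.modEq_iff_dvd]
  refine or_congr ?_ ?_
  · exact exists_congr fun c => by constructor <;> intro h <;> linarith
  · constructor
    · rintro ⟨c, hc⟩
      exact ⟨-c, by linarith⟩
    · rintro ⟨c, hc⟩
      exact ⟨-c, by linarith⟩

theorem sinMul_eq_zero_iff (hℓ : 0 < ℓ) (e : ℤ) :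
    sinMul ℓ e = 0 ↔ e ≡ 0 [ZMOD (2 * ℓ : ℕ)] := by
  have hpi := Real.pi_ne_zero
  have hl : (ℓ : ℝ) ≠ 0 := by exact_mod_cast hℓ.ne'
  rw [sinMul, Real.sin_eq_zero_iff, Int.modEq_zero_iff_dvd]
  refine exists_congr fun c => ?_
  rw [← @Int.cast_inj ℝ]
  push_cast
  field_simp
  constructor <;> intro h <;> linarith

theorem cosMul_eq_sinMul (hℓ : 0 < ℓ) (e : ℤ) : cosMul ℓ e = sinMul ℓ (ℓ - e) := by
  have hl : (ℓ : ℝ) ≠ 0 := by exact_mod_cast hℓ.ne'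
  rw [cosMul, sinMul, ← Real.sin_pi_div_two_sub]
  congr 1
  push_cast
  field_simp

theorem cosMul_lt (hℓ : 0 < ℓ) {p q : ℤ} (hp : 0 ≤ p) (hpq : p < q) (hq : q ≤ 2 * ℓ) :
    cosMul ℓ q < cosMul ℓ p := by
  have hl : (0 : ℝ) < 2 * ℓ := by exact_mod_cast (by omega : 0 < 2 * ℓ)
  have hα : 0 < Real.pi / (2 * ℓ : ℕ) := by push_cast; positivity
  apply Real.cos_lt_cos_of_nonneg_of_le_pi
  · have : (0 : ℝ) ≤ p := by exact_mod_cast hp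
    positivity
  · have : (q : ℝ) ≤ 2 * ℓ := by exact_mod_cast hq
    calc (q : ℝ) * (Real.pi / (2 * ℓ : ℕ)) ≤ (2 * ℓ) * (Real.pi / (2 * ℓ : ℕ)) := by gcongr
      _ = Real.pi := by push_cast; field_simp
  · have : (p : ℝ) < q := by exact_mod_cast hpq
    gcongr

theorem cosMul_le (hℓ : 0 < ℓ) {p q : ℤ} (hp : 0 ≤ p) (hpq : p ≤ q) (hq : q ≤ 2 * ℓ) :
    cosMul ℓ q ≤ cosMul ℓ p := by
  rcases hpq.eq_or_lt with rfl | h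
  · rfl
  · exact (cosMul_lt hℓ hp h hq).le

theorem cosMul_pos {p : ℤ} (hp : 0 ≤ p) (hq : p < ℓ) : 0 < cosMul ℓ p := by
  have hℓ : 0 < ℓ := by omega
  have h := cosMul_lt hℓ hp hq (by omega)
  rwa [cosMul_eq_sinMul hℓ ℓ, sub_self, show sinMul ℓ 0 = 0 by simp [sinMul]] at h

/-- The value of `cosMul` at any integer is its value at an integer of the same parity in
`[0, 2ℓ]`. -/
theorem exists_cosMul_eq (hℓ : 0 < ℓ) (e : ℤ) :
    ∃ f : ℤ, 0 ≤ f ∧ f ≤ 2 * ℓ ∧ f % 2 = e % 2 ∧ cosMul ℓ e = cosMul ℓ f := by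
  have h0 : (0 : ℤ) < (4 * ℓ : ℕ) := by omega
  have h1 := Int.emod_nonneg e h0.ne'
  have h2 := Int.emod_lt_of_pos e h0
  have h3 : e % (4 * ℓ : ℕ) % 2 = e % 2 := Int.emod_emod_of_dvd e ⟨2 * ℓ, by push_cast; ring⟩
  have h4 : e ≡ e % (4 * ℓ : ℕ) [ZMOD (4 * ℓ : ℕ)] := (Int.mod_modEq _ _).symm
  generalize e % (4 * ℓ : ℕ) = f at h1 h2 h3 h4
  rcases le_total f (2 * ℓ) with h | h
  · exact ⟨f, h1, h, h3, (cosMul_eq_iff hℓ _ _).2 (Or.inl h4)⟩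
  · refine ⟨4 * ℓ - f, by omega, by omega, by omega, (cosMul_eq_iff hℓ _ _).2 (Or.inr ?_)⟩
    refine h4.trans (Int.modEq_iff_dvd.2 ⟨-1, by push_cast; ring⟩)

/-- A number strictly between two consecutive values of `cosMul` of the same parity. -/
theorem cosMul_ne_of_between (hℓ : 0 < ℓ) {e k : ℤ} (hk : 0 ≤ k) (hk' : k + 2 ≤ 2 * ℓ)
    (hpar : e % 2 = k % 2) {x y : ℝ} (hy : 0 < y) (h1 : cosMul ℓ (k + 2) * y < x)
    (h2 : x < cosMul ℓ k * y) : cosMul ℓ e * y ≠ x := by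
  obtain ⟨f, hf0, hf, hfe, he⟩ := exists_cosMul_eq hℓ e
  rw [he]
  rcases le_or_gt f k with h | h
  · have := mul_le_mul_of_nonneg_right (cosMul_le hℓ hf0 h (by omega)) hy.le
    linarith
  · have := mul_le_mul_of_nonneg_right
      (cosMul_le hℓ (by omega) (by omega : k + 2 ≤ f) hf) hy.le
    linarith

/-- A number that exceeds every value of `cosMul` of the given parity. -/
theorem cosMul_ne_of_gt (hℓ : 0 < ℓ) {e k : ℤ} (hk : 0 ≤ k) (hk1 : k ≤ 1)
    (hpar : e % 2 = k % 2) {x y : ℝ} (hy : 0 < y) (h1 : cosMul ℓ k * y < x) :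
    cosMul ℓ e * y ≠ x := by
  obtain ⟨f, hf0, hf, hfe, he⟩ := exists_cosMul_eq hℓ e
  rw [he]
  have := mul_le_mul_of_nonneg_right
    (cosMul_le hℓ hk (by omega : k ≤ f) hf) hy.le
  linarith

end Trig

/-! ### Radii, angles and apothems of the classes -/

/-- The radius of the class `v_j`. -/
noncomputable def radius (ℓ : ℕ) : Fin 4 → ℝ :=
  ![1, cosMul ℓ 2 / cosMul ℓ 1, cosMul ℓ 2 * cosMul ℓ 4 / (cosMul ℓ 1 * cosMul ℓ 3),
    cosMul ℓ 4 / cosMul ℓ 3]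

/-- The distance of the lines `L_j` from the origin. -/
noncomputable def apothem (ℓ : ℕ) : Fin 4 → ℝ :=
  ![cosMul ℓ 2, cosMul ℓ 2 * cosMul ℓ 4 / cosMul ℓ 1, cosMul ℓ 2 * cosMul ℓ 4 / cosMul ℓ 3,
    cosMul ℓ 4]

/-- The angle of `(v_j)_0`, in units of `π / m`. -/
def offset : Fin 4 → ℤ := ![0, 1, 2, 1]

/-- The finite point at angle `k π / m` and distance `r` from the origin. -/
noncomputable def polar (ℓ : ℕ) (r : ℝ) (k : ℤ) : Plane := !₂[r * cosMul ℓ k, r * sinMul ℓ k]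

/-- The line at distance `d` from the origin whose normal has angle `n π / m`. -/
noncomputable def normalLine (ℓ : ℕ) (d : ℝ) (n : ℤ) : Set ExtPlane :=
  lineOf ![cosMul ℓ n, sinMul ℓ n, -d]

/-- The line through the origin at angle `k π / m`. -/
noncomputable def centralLine (ℓ : ℕ) (k : ℤ) : Set ExtPlane :=
  lineOf ![-sinMul ℓ k, cosMul ℓ k, 0]

theorem direction_ne_zero (ℓ : ℕ) (k : ℤ) : ![cosMul ℓ k, sinMul ℓ k, 0] ≠ 0 := by
  intro h
  have h0 : cosMul ℓ k = 0 := congrFun h 0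
  have h1 : sinMul ℓ k = 0 := congrFun h 1
  have := cosMul_sq_add_sinMul_sq (ℓ := ℓ) k
  rw [h0, h1] at this
  norm_num at this

/-- The point at infinity in the direction with angle `k π / m`. -/
noncomputable def infPoint (ℓ : ℕ) (k : ℤ) : ExtPlane :=
  Projectivization.mk ℝ ![cosMul ℓ k, sinMul ℓ k, 0] (direction_ne_zero ℓ k)

section Incidence

variable {ℓ : ℕ}

theorem polar_mem_normalLine (r d : ℝ) (k n : ℤ) :
    toExt (polar ℓ r k) ∈ normalLine ℓ d n ↔ r * cosMul ℓ (k - n) = d := by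
  rw [normalLine, toExt_mem_lineOf, cosMul_sub]
  simp [polar]
  constructor <;> intro h <;> linarith

theorem polar_mem_centralLine (r : ℝ) (k n : ℤ) :
    toExt (polar ℓ r k) ∈ centralLine ℓ n ↔ r * sinMul ℓ (k - n) = 0 := by
  rw [centralLine, toExt_mem_lineOf, sinMul_sub]
  simp only [polar, Matrix.cons_val]
  constructor <;> intro h <;> linarith

theorem infPoint_mem_normalLine (hℓ : 0 < ℓ) (d : ℝ) (k n : ℤ) :
    infPoint ℓ k ∈ normalLine ℓ d n ↔ k ≡ n + ℓ [ZMOD (2 * ℓ : ℕ)] := by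
  have h : (![cosMul ℓ k, sinMul ℓ k, 0] ⬝ᵥ ![cosMul ℓ n, sinMul ℓ n, -d]) =
      sinMul ℓ (n + ℓ - k) := by
    rw [show n + ℓ - k = ℓ - (k - n) by ring, ← cosMul_eq_sinMul hℓ, cosMul_sub]
    simp [dotProduct, Fin.sum_univ_three]
  rw [infPoint, normalLine, mk_mem_lineOf, h, sinMul_eq_zero_iff hℓ, Int.modEq_zero_iff_dvd,
    Int.modEq_iff_dvd]

theorem infPoint_mem_centralLine (hℓ : 0 < ℓ) (k n : ℤ) :
    infPoint ℓ k ∈ centralLine ℓ n ↔ k ≡ n [ZMOD (2 * ℓ : ℕ)] := by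
  have h : (![cosMul ℓ k, sinMul ℓ k, 0] ⬝ᵥ ![-sinMul ℓ n, cosMul ℓ n, 0]) =
      sinMul ℓ (k - n) := by
    rw [sinMul_sub]
    simp [dotProduct, Fin.sum_univ_three]
    ring
  rw [infPoint, centralLine, mk_mem_lineOf, h, sinMul_eq_zero_iff hℓ, Int.modEq_zero_iff_dvd,
    Int.modEq_comm, Int.modEq_iff_dvd]

theorem infPoint_mem_lineAtInfinity (k : ℤ) : infPoint ℓ k ∈ lineAtInfinity := by
  rw [infPoint, mk_mem_lineAtInfinity]
  rfl

theorem eq_infPoint {x : ExtPlane} (hx : x ∈ lineAtInfinity) {k : ℤ} (hk : x ∈ centralLine ℓ k) :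
    x = infPoint ℓ k := by
  induction x using Projectivization.ind with
  | h u hu =>
  rw [mk_mem_lineAtInfinity] at hx
  rw [centralLine, mk_mem_lineOf] at hk
  simp [dotProduct, Fin.sum_univ_three] at hk
  have h1 := cosMul_sq_add_sinMul_sq (ℓ := ℓ) k
  rw [infPoint, Projectivization.mk_eq_mk_iff']
  -- The scalar is the inner product of u with the unit direction vector.
  refine ⟨u 0 * cosMul ℓ k + u 1 * sinMul ℓ k, ?_⟩
  ext i
  fin_cases i
  · simp
    linear_combination u 0 * h1 + sinMul ℓ k * hk
  · simp
    linear_combination u 1 * h1 - cosMul ℓ k * hk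
  · simp [hx]

theorem infPoint_eq_iff (hℓ : 0 < ℓ) (k n : ℤ) :
    infPoint ℓ k = infPoint ℓ n ↔ k ≡ n [ZMOD (2 * ℓ : ℕ)] := by
  rw [← infPoint_mem_centralLine hℓ]
  constructor
  · intro h
    rw [h, infPoint_mem_centralLine hℓ]
  · exact eq_infPoint (infPoint_mem_lineAtInfinity k)

theorem polar_eq_iff (hℓ : 0 < ℓ) {r r' : ℝ} (hr : 0 < r) (hr' : 0 < r') (k k' : ℤ) :
    polar ℓ r k = polar ℓ r' k' ↔ r = r' ∧ k ≡ k' [ZMOD (4 * ℓ : ℕ)] := by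
  constructor
  · intro h
    have h0 : r * cosMul ℓ k = r' * cosMul ℓ k' := congrFun (congrArg WithLp.ofLp h) 0
    have h1 : r * sinMul ℓ k = r' * sinMul ℓ k' := congrFun (congrArg WithLp.ofLp h) 1
    have h2 := cosMul_sq_add_sinMul_sq (ℓ := ℓ) k
    have h3 := cosMul_sq_add_sinMul_sq (ℓ := ℓ) k'
    -- The sum of the squared coordinates gives the radius; then cos(k - k') = 1 gives the angle.
    have hrr : r = r' := by
      apply (pow_left_inj₀ hr.le hr'.le two_ne_zero).1
      calc r ^ 2 = (r * cosMul ℓ k) ^ 2 + (r * sinMul ℓ k) ^ 2 := by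
            linear_combination -r ^ 2 * h2
        _ = r' ^ 2 := by rw [h0, h1]; linear_combination r' ^ 2 * h3
    subst hrr
    refine ⟨rfl, ?_⟩
    have h0' := mul_left_cancel₀ hr.ne' h0
    have h1' := mul_left_cancel₀ hr.ne' h1
    have h4 : cosMul ℓ (k - k') = cosMul ℓ 0 := by
      rw [cosMul_sub, h0', h1', cosMul_zero]
      linear_combination h3
    rw [cosMul_eq_iff hℓ, neg_zero, or_self, Int.modEq_zero_iff_dvd] at h4
    exact (Int.modEq_iff_dvd.2 h4).symm
  · rintro ⟨rfl, h⟩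
    obtain ⟨c, hc⟩ := Int.modEq_iff_dvd.1 h
    obtain rfl : k' = k + (4 * ℓ : ℕ) * c := by linarith
    have hl : (ℓ : ℝ) ≠ 0 := by exact_mod_cast hℓ.ne'
    have e : ((k + (4 * ℓ : ℕ) * c : ℤ) : ℝ) * (Real.pi / (2 * ℓ : ℕ)) =
        k * (Real.pi / (2 * ℓ : ℕ)) + c * (2 * Real.pi) := by
      push_cast
      field_simp
      ring
    rw [polar, polar, cosMul, cosMul, sinMul, sinMul, e, Real.cos_add_int_mul_two_pi,
      Real.sin_add_int_mul_two_pi]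

theorem basePoint_eq_polar (hℓ : 5 ≤ ℓ) (j : Fin 4) (i : ℤ) :
    basePoint ℓ j i = polar ℓ (radius ℓ j) (offset j + 2 * i) := by
  have h0 : Finset.Iio (0 : Fin 4) = ∅ := by decide
  have h1 : Finset.Iio (1 : Fin 4) = {0} := by decide
  have h2 : Finset.Iio (2 : Fin 4) = {0, 1} := by decide
  have h3 : Finset.Iio (3 : Fin 4) = {0, 1, 2} := by decide
  have hc : ∀ k : ℕ, Real.cos (k * Real.pi / (2 * ℓ : ℕ)) = cosMul ℓ k := by
    intro k
    rw [cosMul, mul_div_assoc]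
    rfl
  have hr : ∏ a ∈ Finset.Iio j, Real.cos (spanS a * Real.pi / (2 * ℓ : ℕ)) /
      Real.cos (spanT a * Real.pi / (2 * ℓ : ℕ)) = radius ℓ j := by
    have c1 : cosMul ℓ 1 ≠ 0 := (cosMul_pos (by norm_num) (by omega)).ne'
    have c2 : cosMul ℓ 2 ≠ 0 := (cosMul_pos (by norm_num) (by omega)).ne'
    simp only [hc]
    fin_cases j
    · simp [h0, radius]
    · simp [h1, radius, spanS, spanT]
    · simp [h2, radius, spanS, spanT]
    · simp [h3, radius, spanS, spanT]
      field_simp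
  have ho : ∑ a ∈ Finset.Iio j, ((spanS a : ℝ) - spanT a) = offset j := by
    fin_cases j
    · simp [h0, offset]
    · simp [h1, offset, spanS, spanT]; norm_num
    · simp [h2, offset, spanS, spanT]; norm_num
    · simp [h3, offset, spanS, spanT]; norm_num
  have hθ : (offset j : ℝ) * Real.pi / (2 * ℓ : ℕ) + 2 * Real.pi * i / (2 * ℓ : ℕ) =
      ((offset j + 2 * i : ℤ) : ℝ) * (Real.pi / (2 * ℓ : ℕ)) := by
    push_cast
    ring
  rw [basePoint, celestialPoint]
  simp only [hr, ho, hθ]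
  rfl

theorem rotate_polar (r : ℝ) (k n : ℤ) :
    rotate (n * (Real.pi / (2 * ℓ : ℕ))) (polar ℓ r k) = polar ℓ r (k + n) := by
  have h1 : cosMul ℓ (k + n) = cosMul ℓ k * cosMul ℓ n - sinMul ℓ k * sinMul ℓ n := by
    simp only [cosMul, sinMul, Int.cast_add, add_mul, Real.cos_add]
  have h2 : sinMul ℓ (k + n) = sinMul ℓ k * cosMul ℓ n + cosMul ℓ k * sinMul ℓ n := by
    simp only [cosMul, sinMul, Int.cast_add, add_mul, Real.sin_add]
  change rotate _ _ = !₂[r * cosMul ℓ (k + n), r * sinMul ℓ (k + n)]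
  rw [h1, h2]
  ext i
  fin_cases i
  · simp [rotate, polar, cosMul, sinMul]
    ring
  · simp [rotate, polar, cosMul, sinMul]
    ring

theorem radius_pos (hℓ : 5 ≤ ℓ) (j : Fin 4) : 0 < radius ℓ j := by
  have c1 : 0 < cosMul ℓ 1 := cosMul_pos (by norm_num) (by omega)
  have c2 : 0 < cosMul ℓ 2 := cosMul_pos (by norm_num) (by omega)
  have c3 : 0 < cosMul ℓ 3 := cosMul_pos (by norm_num) (by omega)
  have c4 : 0 < cosMul ℓ 4 := cosMul_pos (by norm_num) (by omega)
  fin_cases j <;> simp [radius] <;> positivity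

theorem radius_mul_cosMul_spanS (hℓ : 5 ≤ ℓ) (j : Fin 4) :
    radius ℓ j * cosMul ℓ (spanS j) = apothem ℓ j := by
  have c1 : cosMul ℓ 1 ≠ 0 := (cosMul_pos (by norm_num) (by omega)).ne'
  have c3 : cosMul ℓ 3 ≠ 0 := (cosMul_pos (by norm_num) (by omega)).ne'
  fin_cases j <;> simp [radius, apothem, spanS] <;> field_simp

theorem radius_mul_cosMul_spanT (hℓ : 5 ≤ ℓ) (j : Fin 4) :
    radius ℓ (j + 1) * cosMul ℓ (spanT j) = apothem ℓ j := by
  have c1 : cosMul ℓ 1 ≠ 0 := (cosMul_pos (by norm_num) (by omega)).ne'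
  have c3 : cosMul ℓ 3 ≠ 0 := (cosMul_pos (by norm_num) (by omega)).ne'
  fin_cases j <;> simp [radius, apothem, spanT] <;> field_simp

/-- With x = k - i, the two signs in cos(2x - q) = cos q become the two points of a class on a line.
-/
theorem two_mul_sub_modEq_iff (x q : ℤ) :
    (2 * x - q ≡ q [ZMOD (4 * ℓ : ℕ)] ∨ 2 * x - q ≡ -q [ZMOD (4 * ℓ : ℕ)]) ↔
      (x ≡ 0 [ZMOD (2 * ℓ : ℕ)] ∨ x ≡ q [ZMOD (2 * ℓ : ℕ)]) := by
  simp only [Int.modEq_iff_dvd]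
  push_cast
  rw [or_comm]
  refine or_congr ?_ ?_
  · rw [show -q - (2 * x - q) = 2 * (0 - x) by ring, show (4 : ℤ) * ℓ = 2 * (2 * ℓ) by ring]
    exact mul_dvd_mul_iff_left two_ne_zero
  · rw [show q - (2 * x - q) = 2 * (q - x) by ring, show (4 : ℤ) * ℓ = 2 * (2 * ℓ) by ring]
    exact mul_dvd_mul_iff_left two_ne_zero

/-- The points that are not on a line of a class for a reason of size. -/
theorem radius_mul_cosMul_ne_apothem (hℓ : 5 ≤ ℓ) (a j : Fin 4) (haj : a ≠ j) (haj' : a ≠ j + 1)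
    {e : ℤ} (he : e % 2 = (offset a - offset j - spanS j) % 2) :
    radius ℓ a * cosMul ℓ e ≠ apothem ℓ j := by
  have h0 : 0 < ℓ := by omega
  have c1 : 0 < cosMul ℓ 1 := cosMul_pos (by norm_num) (by omega)
  have c2 : 0 < cosMul ℓ 2 := cosMul_pos (by norm_num) (by omega)
  have c3 : 0 < cosMul ℓ 3 := cosMul_pos (by norm_num) (by omega)
  have c4 : 0 < cosMul ℓ 4 := cosMul_pos (by norm_num) (by omega)
  have l01 : cosMul ℓ 1 < 1 := by
    simpa using cosMul_lt h0 le_rfl (by norm_num : (0 : ℤ) < 1) (by omega)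
  have l12 := cosMul_lt h0 (by norm_num) (by norm_num : (1 : ℤ) < 2) (by omega)
  have l23 := cosMul_lt h0 (by norm_num) (by norm_num : (2 : ℤ) < 3) (by omega)
  have l34 := cosMul_lt h0 (by norm_num) (by norm_num : (3 : ℤ) < 4) (by omega)
  have l45 := cosMul_lt h0 (by norm_num) (by norm_num : (4 : ℤ) < 5) (by omega)
  have l56 := cosMul_lt h0 (by norm_num) (by norm_num : (5 : ℤ) < 6) (by omega)
  have l67 := cosMul_lt h0 (by norm_num) (by norm_num : (6 : ℤ) < 7) (by omega)
  have l78 := cosMul_lt h0 (by norm_num) (by norm_num : (7 : ℤ) < 8) (by omega)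
  have l1434 := mul_lt_mul_of_pos_right (l23.trans l12) c4
  -- After denominators are cleared, both sides of each comparison are products of two cosines.
  -- Written as sums, they differ by the order of single cosines.
  have p12 := two_mul_cosMul_mul_cosMul (ℓ := ℓ) 2 1
  have p13 := two_mul_cosMul_mul_cosMul (ℓ := ℓ) 3 1
  have p14 := two_mul_cosMul_mul_cosMul (ℓ := ℓ) 4 1
  have p15 := two_mul_cosMul_mul_cosMul (ℓ := ℓ) 5 1
  have p22 := two_mul_cosMul_mul_cosMul (ℓ := ℓ) 2 2
  have p23 := two_mul_cosMul_mul_cosMul (ℓ := ℓ) 3 2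
  have p24 := two_mul_cosMul_mul_cosMul (ℓ := ℓ) 4 2
  have p25 := two_mul_cosMul_mul_cosMul (ℓ := ℓ) 5 2
  have p33 := two_mul_cosMul_mul_cosMul (ℓ := ℓ) 3 3
  have p35 := two_mul_cosMul_mul_cosMul (ℓ := ℓ) 5 3
  norm_num at p12 p13 p14 p15 p22 p23 p24 p25 p33 p35
  fin_cases j <;> fin_cases a <;>
    simp [radius, apothem, offset, spanS] at haj haj' he ⊢
  all_goals
    intro h
    field_simp at h
  -- For `j = 0` the cosine would have to exceed the largest value of its parity, cos 0 or cos 1. In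
  -- the other six cases it falls between cos 2 and cos 4 or between cos 3 and cos 5.
  · exact cosMul_ne_of_gt h0 (k := 0) (by norm_num) (by norm_num) (by omega) c4
      (by norm_num; linarith) ((mul_comm _ _).trans h)
  · exact cosMul_ne_of_gt h0 (k := 1) (by norm_num) (by norm_num) (by omega) c4
      (by linarith) ((mul_comm _ _).trans h)
  · exact cosMul_ne_of_between h0 (k := 3) (by norm_num) (by omega) (by omega) c1
      (by norm_num; linarith) (by linarith) h
  · exact cosMul_ne_of_between h0 (k := 2) (by norm_num) (by omega) (by omega) c1
      (by norm_num; linarith) (by linarith) h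
  · exact cosMul_ne_of_between h0 (k := 3) (by norm_num) (by omega) (by omega) c3
      (by norm_num; linarith) (by linarith) h
  · exact cosMul_ne_of_between h0 (k := 2) (by norm_num) (by omega) (by omega) c3
      (by norm_num; linarith) (by linarith) h
  · exact cosMul_ne_of_between h0 (k := 3) (by norm_num) (by omega) (by omega) c2
      (by norm_num; linarith) (by linarith) ((mul_comm _ _).trans h)
  · exact cosMul_ne_of_between h0 (k := 2) (by norm_num) (by omega) (by omega) c2
      (by norm_num; linarith) (by linarith) ((mul_comm _ _).trans h)

/-- Parity of the angle already separates classes with different offset parity, so only `v_0`, `v_2`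
and `v_1`, `v_3` need different radii. -/
theorem radius_injective_of_parity (hℓ : 5 ≤ ℓ) {a b : Fin 4} (h : radius ℓ a = radius ℓ b)
    (hpar : offset a % 2 = offset b % 2) : a = b := by
  have h0 : 0 < ℓ := by omega
  have c1 : 0 < cosMul ℓ 1 := cosMul_pos (by norm_num) (by omega)
  have c3 : 0 < cosMul ℓ 3 := cosMul_pos (by norm_num) (by omega)
  have l13 := cosMul_lt h0 (by norm_num) (by norm_num : (1 : ℤ) < 3) (by omega)
  have l46 := cosMul_lt h0 (by norm_num) (by norm_num : (4 : ℤ) < 6) (by omega)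
  have p13 := two_mul_cosMul_mul_cosMul (ℓ := ℓ) 3 1
  have p14 := two_mul_cosMul_mul_cosMul (ℓ := ℓ) 4 1
  have p23 := two_mul_cosMul_mul_cosMul (ℓ := ℓ) 3 2
  have p24 := two_mul_cosMul_mul_cosMul (ℓ := ℓ) 4 2
  norm_num at p13 p14 p23 p24
  have n02 : radius ℓ 2 ≠ radius ℓ 0 := by
    simp only [radius, Matrix.cons_val, ne_eq]
    rw [div_eq_one_iff_eq (by positivity)]
    intro h
    linarith
  have n13 : radius ℓ 3 ≠ radius ℓ 1 := by
    simp only [radius, Matrix.cons_val, ne_eq]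
    rw [div_eq_div_iff c3.ne' c1.ne']
    intro h
    linarith
  fin_cases a <;> fin_cases b <;> first
    | rfl
    | exact absurd hpar (by decide)
    | exact absurd h n02
    | exact absurd h.symm n02
    | exact absurd h n13
    | exact absurd h.symm n13

theorem basePoint_eq_iff (hℓ : 5 ≤ ℓ) (j j' : Fin 4) (i i' : ℤ) :
    basePoint ℓ j i = basePoint ℓ j' i' ↔ j = j' ∧ i ≡ i' [ZMOD (2 * ℓ : ℕ)] := by
  rw [basePoint_eq_polar hℓ, basePoint_eq_polar hℓ,
    polar_eq_iff (by omega) (radius_pos hℓ j) (radius_pos hℓ j')]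
  have key : ∀ k : ℤ, (k + 2 * i ≡ k + 2 * i' [ZMOD (4 * ℓ : ℕ)]) ↔
      i ≡ i' [ZMOD (2 * ℓ : ℕ)] := by
    intro k
    rw [Int.modEq_iff_dvd, Int.modEq_iff_dvd,
      show k + 2 * i' - (k + 2 * i) = 2 * (i' - i) by ring,
      show ((4 * ℓ : ℕ) : ℤ) = 2 * (2 * ℓ : ℕ) by push_cast; ring]
    exact mul_dvd_mul_iff_left two_ne_zero
  constructor
  · rintro ⟨hr, h⟩
    have hpar : offset j % 2 = offset j' % 2 := by
      -- The modulus 4ℓ is even, so the congruence of angles can be read modulo 2.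
      have h2 : offset j + 2 * i ≡ offset j' + 2 * i' [ZMOD 2] :=
        h.of_dvd ⟨2 * ℓ, by push_cast; ring⟩
      have := h2.eq
      omega
    obtain rfl := radius_injective_of_parity hℓ hr hpar
    exact ⟨rfl, (key _).1 h⟩
  · rintro ⟨rfl, h⟩
    exact ⟨rfl, (key _).2 h⟩

/-- The incidences of the points `(v_a)_k` and the lines `(L_j)_i`. -/
theorem basePoint_mem_normalLine (hℓ : 5 ≤ ℓ) (a j : Fin 4) (k i : ℤ) :
    toExt (basePoint ℓ a k) ∈ normalLine ℓ (apothem ℓ j) (offset j + spanS j + 2 * i) ↔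
      (a = j ∧ (k ≡ i [ZMOD (2 * ℓ : ℕ)] ∨ k ≡ i + spanS j [ZMOD (2 * ℓ : ℕ)])) ∨
      (a = j + 1 ∧ (k ≡ i [ZMOD (2 * ℓ : ℕ)] ∨ k ≡ i + spanT j [ZMOD (2 * ℓ : ℕ)])) := by
  have hj : j ≠ j + 1 := by revert j; decide
  have hshift : ∀ q : ℤ, (k - i ≡ 0 [ZMOD (2 * ℓ : ℕ)] ∨ k - i ≡ q [ZMOD (2 * ℓ : ℕ)]) ↔
      (k ≡ i [ZMOD (2 * ℓ : ℕ)] ∨ k ≡ i + q [ZMOD (2 * ℓ : ℕ)]) := by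
    intro q
    simp only [Int.modEq_iff_dvd]
    rw [show (0 : ℤ) - (k - i) = i - k by ring, show q - (k - i) = i + q - k by ring]
  rw [basePoint_eq_polar hℓ, polar_mem_normalLine]
  by_cases h1 : a = j
  · subst h1
    rw [← radius_mul_cosMul_spanS hℓ, mul_right_inj' (radius_pos hℓ a).ne',
      show offset a + 2 * k - (offset a + spanS a + 2 * i) = 2 * (k - i) - spanS a by ring,
      cosMul_eq_iff (by omega), two_mul_sub_modEq_iff, hshift]
    simp [hj]
  by_cases h2 : a = j + 1
  · subst h2
    -- This also holds for `j = 3`, where `j + 1 = 0`: the total rotation 1 + 3 - 4 vanishes, so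
    -- there is no index shift on closing the cycle.
    have ho : offset (j + 1) = offset j + spanS j - spanT j := by revert j; decide
    rw [← radius_mul_cosMul_spanT hℓ, mul_right_inj' (radius_pos hℓ _).ne', ho,
      show offset j + spanS j - spanT j + 2 * k - (offset j + spanS j + 2 * i) =
        2 * (k - i) - spanT j by ring,
      cosMul_eq_iff (by omega), two_mul_sub_modEq_iff, hshift]
    simp
  · simp only [h1, h2, false_and, or_self, iff_false]
    exact radius_mul_cosMul_ne_apothem hℓ a j h1 h2 (by omega)

theorem basePoint_mem_centralLine (hℓ : 5 ≤ ℓ) (a : Fin 4) (k n : ℤ) :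
    toExt (basePoint ℓ a k) ∈ centralLine ℓ n ↔ n ≡ offset a + 2 * k [ZMOD (2 * ℓ : ℕ)] := by
  rw [basePoint_eq_polar hℓ, polar_mem_centralLine, mul_eq_zero_iff_left (radius_pos hℓ a).ne',
    sinMul_eq_zero_iff (by omega), Int.modEq_zero_iff_dvd, Int.modEq_iff_dvd]

theorem toExt_ne_toExt (hℓ : 5 ≤ ℓ) (j : Fin 4) (i : ℤ) :
    toExt (basePoint ℓ j i) ≠ toExt (basePoint ℓ j (i + spanS j)) := by
  intro h
  have h1 := ((basePoint_eq_iff hℓ _ _ _ _).1 (toExt_injective h)).2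
  have h2 := Int.modEq_iff_dvd.1 h1
  rw [add_sub_cancel_left] at h2
  have h3 : 0 < spanS j ∧ spanS j ≤ 4 := by clear h h1 h2; revert j; decide
  have h4 := Int.le_of_dvd (by omega) h2
  omega

theorem celestialLine_eq (hℓ : 5 ≤ ℓ) (j : Fin 4) (i : ℤ) :
    celestialLine spanS (basePoint ℓ) j i =
      normalLine ℓ (apothem ℓ j) (offset j + spanS j + 2 * i) := by
  refine join_eq_lineOf (toExt_ne_toExt hℓ j i) ?_ ?_ ?_
  · intro h
    apply direction_ne_zero ℓ (offset j + spanS j + 2 * i)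
    ext n
    fin_cases n
    · exact congrFun h 0
    · exact congrFun h 1
    · rfl
  · exact (basePoint_mem_normalLine hℓ j j i i).2 (Or.inl ⟨rfl, Or.inl rfl⟩)
  · exact (basePoint_mem_normalLine hℓ j j _ i).2 (Or.inl ⟨rfl, Or.inr rfl⟩)

theorem join_zero_polar (k : ℤ) {r : ℝ} (hr : r ≠ 0) :
    join (toExt 0) (toExt (polar ℓ r k)) = centralLine ℓ k := by
  have h1 := cosMul_sq_add_sinMul_sq (ℓ := ℓ) k
  refine join_eq_lineOf ?_ ?_ ?_ ?_
  · intro h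
    have h := toExt_injective h
    have h2 : 0 = r * cosMul ℓ k := congrFun (congrArg WithLp.ofLp h) 0
    have h3 : 0 = r * sinMul ℓ k := congrFun (congrArg WithLp.ofLp h) 1
    have h2' : cosMul ℓ k = 0 := by simpa [hr] using h2.symm
    have h3' : sinMul ℓ k = 0 := by simpa [hr] using h3.symm
    rw [h2', h3'] at h1
    norm_num at h1
  · intro h
    have h2 : -sinMul ℓ k = 0 := congrFun h 0
    have h3 : cosMul ℓ k = 0 := congrFun h 1
    rw [neg_eq_zero.1 h2, h3] at h1
    norm_num at h1
  · rw [toExt_mem_lineOf]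
    simp
  · exact (polar_mem_centralLine r k k).2 (by simp [sinMul])

/-- Even angles give the diameters, odd angles the mid-diameters. -/
theorem diameters_union_midDiameters (hℓ : 5 ≤ ℓ) :
    diameters ℓ ∪ midDiameters ℓ = Set.range (centralLine ℓ) := by
  have hd : ∀ i, join (toExt 0) (toExt (basePoint ℓ 0 i)) = centralLine ℓ (2 * i) := by
    intro i
    rw [basePoint_eq_polar hℓ, join_zero_polar _ (radius_pos hℓ 0).ne']
    simp [offset]
  have hm : ∀ i, join (toExt 0) (toExt (rotate (Real.pi / (2 * ℓ : ℕ)) (basePoint ℓ 0 i))) =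
      centralLine ℓ (2 * i + 1) := by
    intro i
    have h1 := rotate_polar (ℓ := ℓ) (radius ℓ 0) (offset 0 + 2 * i) 1
    rw [Int.cast_one, one_mul] at h1
    rw [basePoint_eq_polar hℓ, h1, join_zero_polar _ (radius_pos hℓ 0).ne']
    simp [offset]
  ext l
  constructor
  · rintro (⟨i, rfl⟩ | ⟨i, rfl⟩)
    · exact ⟨_, (hd i).symm⟩
    · exact ⟨_, (hm i).symm⟩
  · rintro ⟨k, rfl⟩
    rcases Int.even_or_odd' k with ⟨i, rfl | rfl⟩
    · exact Or.inl ⟨i, (hd i).symm⟩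
    · exact Or.inr ⟨i, (hm i).symm⟩

end Incidence

/-! ### Points and lines indexed by residues -/

section Index

variable {ℓ : ℕ}

theorem zmod_cast_modEq_iff (x : ZMod (2 * ℓ)) (n : ℤ) :
    (x.cast : ℤ) ≡ n [ZMOD (2 * ℓ : ℕ)] ↔ x = n := by
  rw [← ZMod.intCast_eq_intCast_iff, ZMod.intCast_zmod_cast]

variable (ℓ) in
/-- The points `(v_a)_k`. -/
noncomputable def celPoint (x : Fin 4 × ZMod (2 * ℓ)) : ExtPlane :=
  toExt (basePoint ℓ x.1 x.2.cast)

variable (ℓ) in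
/-- The lines `(L_j)_i`. -/
noncomputable def celLine (y : Fin 4 × ZMod (2 * ℓ)) : Set ExtPlane :=
  celestialLine spanS (basePoint ℓ) y.1 y.2.cast

variable (ℓ) in
/-- All points of `D₄(ℓ)`. -/
noncomputable def pointOf : Fin 4 × ZMod (2 * ℓ) ⊕ ZMod (2 * ℓ) → ExtPlane :=
  Sum.elim (celPoint ℓ) (fun k => infPoint ℓ k.cast)

variable (ℓ) in
/-- All lines of `D₄(ℓ)`. -/
noncomputable def lineFor : Fin 4 × ZMod (2 * ℓ) ⊕ ZMod (2 * ℓ) → Set ExtPlane :=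
  Sum.elim (celLine ℓ) (fun k => centralLine ℓ k.cast)

theorem celPoint_mem_celLine (hℓ : 5 ≤ ℓ) (a j : Fin 4) (k i : ZMod (2 * ℓ)) :
    celPoint ℓ (a, k) ∈ celLine ℓ (j, i) ↔
      (a = j ∧ (k = i ∨ k = i + spanS j)) ∨ (a = j + 1 ∧ (k = i ∨ k = i + spanT j)) := by
  rw [celPoint, celLine, celestialLine_eq hℓ, basePoint_mem_normalLine hℓ]
  simp only [zmod_cast_modEq_iff, Int.cast_add, ZMod.intCast_zmod_cast, Int.cast_natCast]

theorem celPoint_mem_centralLine (hℓ : 5 ≤ ℓ) (a : Fin 4) (k n : ZMod (2 * ℓ)) :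
    celPoint ℓ (a, k) ∈ centralLine ℓ n.cast ↔ n = offset a + 2 * k := by
  rw [celPoint, basePoint_mem_centralLine hℓ, zmod_cast_modEq_iff]
  simp

theorem infPoint_mem_celLine (hℓ : 5 ≤ ℓ) (j : Fin 4) (k i : ZMod (2 * ℓ)) :
    infPoint ℓ k.cast ∈ celLine ℓ (j, i) ↔ k = (offset j + spanS j : ℤ) + 2 * i + ℓ := by
  rw [celLine, celestialLine_eq hℓ, infPoint_mem_normalLine (by omega), zmod_cast_modEq_iff]
  simp

theorem infPoint_mem_centralLine_cast (hℓ : 5 ≤ ℓ) (k n : ZMod (2 * ℓ)) :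
    infPoint ℓ k.cast ∈ centralLine ℓ n.cast ↔ k = n := by
  rw [infPoint_mem_centralLine (by omega), zmod_cast_modEq_iff]
  simp

theorem centralLine_eq_join (hℓ : 5 ≤ ℓ) (k : ℤ) :
    centralLine ℓ k = join (toExt 0) (infPoint ℓ k) := by
  refine (join_eq_lineOf ?_ ?_ ?_ ?_).symm
  · intro h
    exact toExt_notMem_lineAtInfinity 0 (h ▸ infPoint_mem_lineAtInfinity k)
  · intro h
    have h2 : -sinMul ℓ k = 0 := congrFun h 0
    have h3 : cosMul ℓ k = 0 := congrFun h 1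
    have h1 := cosMul_sq_add_sinMul_sq (ℓ := ℓ) k
    rw [neg_eq_zero.1 h2, h3] at h1
    norm_num at h1
  · rw [toExt_mem_lineOf]
    simp
  · exact (infPoint_mem_centralLine (by omega) k k).2 rfl

theorem toExt_zero_mem_centralLine (hℓ : 5 ≤ ℓ) (k : ℤ) : toExt 0 ∈ centralLine ℓ k := by
  rw [centralLine_eq_join hℓ]
  exact left_mem_join _ _

theorem centralLine_mem_extLines (hℓ : 5 ≤ ℓ) (k : ℤ) : centralLine ℓ k ∈ extLines :=
  ⟨toExt 0, infPoint ℓ k,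
    fun h => toExt_notMem_lineAtInfinity 0 (h ▸ infPoint_mem_lineAtInfinity k),
    centralLine_eq_join hℓ k⟩

theorem centralLine_cast (hℓ : 5 ≤ ℓ) (k : ℤ) :
    centralLine ℓ ((k : ZMod (2 * ℓ)).cast) = centralLine ℓ k := by
  rw [centralLine_eq_join hℓ, centralLine_eq_join hℓ,
    (infPoint_eq_iff (by omega) _ k).2 ((zmod_cast_modEq_iff _ _).2 rfl)]

theorem celLine_mem_extLines (hℓ : 5 ≤ ℓ) (y : Fin 4 × ZMod (2 * ℓ)) : celLine ℓ y ∈ extLines :=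
  ⟨_, _, toExt_ne_toExt hℓ y.1 y.2.cast, rfl⟩

theorem range_celPoint (hℓ : 5 ≤ ℓ) :
    celestialPoints (basePoint ℓ) = Set.range (celPoint ℓ) := by
  ext x
  constructor
  · rintro ⟨j, i, rfl⟩
    refine ⟨(j, i), ?_⟩
    rw [celPoint, (basePoint_eq_iff hℓ _ j _ i).2 ⟨rfl, (zmod_cast_modEq_iff _ _).2 rfl⟩]
  · rintro ⟨y, rfl⟩
    exact ⟨_, _, rfl⟩

theorem range_celLine (hℓ : 5 ≤ ℓ) :
    celestialLines spanS (basePoint ℓ) = Set.range (celLine ℓ) := by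
  ext x
  constructor
  · rintro ⟨j, i, rfl⟩
    refine ⟨(j, i), ?_⟩
    rw [celLine, celestialLine, celestialLine,
      (basePoint_eq_iff hℓ _ j _ i).2 ⟨rfl, (zmod_cast_modEq_iff _ _).2 rfl⟩,
      (basePoint_eq_iff hℓ _ j _ (i + spanS j)).2
        ⟨rfl, ((zmod_cast_modEq_iff _ _).2 rfl).add_right _⟩]
  · rintro ⟨y, rfl⟩
    exact ⟨_, _, rfl⟩

theorem range_pointOf (hℓ : 5 ≤ ℓ) : points ℓ = Set.range (pointOf ℓ) := by
  rw [points, range_celPoint hℓ, diameters_union_midDiameters hℓ, pointOf, Set.Sum.elim_range]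
  congr 1
  ext x
  constructor
  · rintro ⟨hx, _, ⟨k, rfl⟩, hk⟩
    refine ⟨k, ?_⟩
    rw [eq_infPoint hx hk]
    exact (infPoint_eq_iff (by omega) _ k).2 ((zmod_cast_modEq_iff _ _).2 rfl)
  · rintro ⟨k, rfl⟩
    exact ⟨infPoint_mem_lineAtInfinity _, _, ⟨k.cast, rfl⟩,
      (infPoint_mem_centralLine (by omega) _ _).2 rfl⟩

theorem range_lineFor (hℓ : 5 ≤ ℓ) : lines ℓ = Set.range (lineFor ℓ) := by
  rw [lines, range_celLine hℓ, Set.union_assoc, diameters_union_midDiameters hℓ, lineFor,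
    Set.Sum.elim_range]
  congr 1
  ext x
  constructor
  · rintro ⟨k, rfl⟩
    exact ⟨k, centralLine_cast hℓ k⟩
  · rintro ⟨k, rfl⟩
    exact ⟨k.cast, rfl⟩

theorem natCast_zmod_ne_zero {c : ℕ} (h0 : 0 < c) (h : c < 2 * ℓ) : (c : ZMod (2 * ℓ)) ≠ 0 := by
  rw [ne_eq, ZMod.natCast_eq_zero_iff]
  exact fun hd => absurd (Nat.le_of_dvd h0 hd) (by omega)

theorem spanS_bounds (j : Fin 4) : 0 < spanS j ∧ spanS j ≤ 4 := by revert j; decide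

theorem spanT_bounds (j : Fin 4) : 0 < spanT j ∧ spanT j ≤ 4 := by revert j; decide

theorem spanS_ne_zero (hℓ : 5 ≤ ℓ) (j : Fin 4) : (spanS j : ZMod (2 * ℓ)) ≠ 0 :=
  have := spanS_bounds j
  natCast_zmod_ne_zero (by omega) (by omega)

theorem spanT_ne_zero (hℓ : 5 ≤ ℓ) (j : Fin 4) : (spanT j : ZMod (2 * ℓ)) ≠ 0 :=
  have := spanT_bounds j
  natCast_zmod_ne_zero (by omega) (by omega)

theorem two_mul_spanS_ne_zero (hℓ : 5 ≤ ℓ) (j : Fin 4) : (2 * spanS j : ZMod (2 * ℓ)) ≠ 0 := by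
  have := spanS_bounds j
  exact_mod_cast natCast_zmod_ne_zero (ℓ := ℓ) (c := 2 * spanS j) (by omega) (by omega)

theorem half_ne_zero (hℓ : 5 ≤ ℓ) : (ℓ : ZMod (2 * ℓ)) ≠ 0 :=
  natCast_zmod_ne_zero (by omega) (by omega)

theorem celPoint_injective (hℓ : 5 ≤ ℓ) : Function.Injective (celPoint ℓ) := by
  rintro ⟨a, k⟩ ⟨b, n⟩ h
  have := (basePoint_eq_iff hℓ _ _ _ _).1 (toExt_injective h)
  rw [zmod_cast_modEq_iff, ZMod.intCast_zmod_cast] at this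
  exact Prod.ext this.1 this.2

theorem celLine_injective (hℓ : 5 ≤ ℓ) : Function.Injective (celLine ℓ) := by
  rintro ⟨j, i⟩ ⟨j', i'⟩ h
  have key : ∀ a k, celPoint ℓ (a, k) ∈ celLine ℓ (j, i) →
      celPoint ℓ (a, k) ∈ celLine ℓ (j', i') :=
    fun a k hk => h ▸ hk
  simp only [celPoint_mem_celLine hℓ] at key
  have h1 := key j i (Or.inl ⟨rfl, Or.inl rfl⟩)
  have h2 := key j (i + spanS j) (Or.inl ⟨rfl, Or.inr rfl⟩)
  have h3 := key (j + 1) i (Or.inr ⟨rfl, Or.inl rfl⟩)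
  -- A line meets the classes `j` and `j + 1`, and in ℤ/4 such a pair determines `j`.
  have hjj : j = j' := by
    have h1' : j = j' ∨ j = j' + 1 := h1.imp And.left And.left
    have h3' : j + 1 = j' ∨ j + 1 = j' + 1 := h3.imp And.left And.left
    clear h1 h2 h3 key h
    revert j j'
    decide
  subst hjj
  have hj : j ≠ j + 1 := by clear h1 h2 h3 key h; revert j; decide
  simp only [hj, true_and, false_and, or_false] at h1 h2
  rcases h1 with rfl | rfl
  · rfl
  · rcases h2 with h2 | h2
    · exact absurd (by linear_combination h2) (two_mul_spanS_ne_zero hℓ j)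
    · exact absurd (by linear_combination h2) (spanS_ne_zero hℓ j)

theorem pointOf_injective (hℓ : 5 ≤ ℓ) : Function.Injective (pointOf ℓ) := by
  refine (celPoint_injective hℓ).sumElim ?_ ?_
  · intro k n h
    have := (infPoint_eq_iff (by omega) _ _).1 h
    rwa [zmod_cast_modEq_iff, ZMod.intCast_zmod_cast] at this
  · intro x k h
    exact toExt_notMem_lineAtInfinity _ (h ▸ infPoint_mem_lineAtInfinity k.cast :
      celPoint ℓ x ∈ lineAtInfinity)

theorem lineFor_injective (hℓ : 5 ≤ ℓ) : Function.Injective (lineFor ℓ) := by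
  refine (celLine_injective hℓ).sumElim ?_ ?_
  · intro k n (h : centralLine ℓ k.cast = centralLine ℓ n.cast)
    rw [← infPoint_mem_centralLine_cast hℓ, ← h, infPoint_mem_centralLine_cast hℓ]
  · rintro ⟨j, i⟩ n h
    have key : ∀ a k, celPoint ℓ (a, k) ∈ celLine ℓ (j, i) →
        celPoint ℓ (a, k) ∈ centralLine ℓ n.cast := fun a k hk => h ▸ hk
    simp only [celPoint_mem_celLine hℓ, celPoint_mem_centralLine hℓ] at key
    have h1 := key j i (Or.inl ⟨rfl, Or.inl rfl⟩)
    have h2 := key j (i + spanS j) (Or.inl ⟨rfl, Or.inr rfl⟩)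
    -- Two points of class `j` on a common central line would be opposite, but twice the span is at
    -- most 8 < 2ℓ.
    exact two_mul_spanS_ne_zero hℓ j (by linear_combination h1 - h2)

/-! ### Counting incidences -/

theorem encard_setOf_sum {A B : Type} (p : A ⊕ B → Prop) :
    {x | p x}.encard = {a | p (Sum.inl a)}.encard + {b | p (Sum.inr b)}.encard := by
  rw [← Sum.inl_injective.encard_image (β := A ⊕ B), ← Sum.inr_injective.encard_image (β := A ⊕ B),
    ← Set.encard_union_eq]
  · congr 1
    ext (a | b) <;> simp
  · rw [Set.disjoint_left]
    rintro _ ⟨a, -, rfl⟩ ⟨b, -, h⟩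
    cases h

/-- Doubling modulo 2ℓ has kernel {0, ℓ} and its image consists of the even residues. Hence a
solution requires equal parity, and then there are exactly two. -/
theorem eq_add_two_mul_iff (N f : ℤ) (z : ZMod (2 * ℓ)) :
    (N : ZMod (2 * ℓ)) = f + 2 * z ↔
      f % 2 = N % 2 ∧ (z = ((N - f) / 2 : ℤ) ∨ z = ((N - f) / 2 : ℤ) + ℓ) := by
  constructor
  · intro h
    obtain ⟨w, rfl⟩ := ZMod.intCast_surjective z
    have h1 : (N : ZMod (2 * ℓ)) = ((f + 2 * w : ℤ) : ZMod (2 * ℓ)) := by push_cast; exact h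
    rw [ZMod.intCast_eq_intCast_iff, Int.modEq_iff_dvd] at h1
    obtain ⟨c, hc⟩ := h1
    push_cast at hc
    have hN : N - f = 2 * (w - ℓ * c) := by linarith
    refine ⟨by omega, ?_⟩
    rw [hN, Int.mul_ediv_cancel_left _ two_ne_zero]
    have h2 : (2 * ℓ : ZMod (2 * ℓ)) = 0 := by exact_mod_cast ZMod.natCast_self (2 * ℓ)
    rcases Int.even_or_odd' c with ⟨b, rfl | rfl⟩
    · left
      push_cast
      linear_combination b * h2
    · right
      push_cast
      linear_combination b * h2
  · rintro ⟨hpar, h⟩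
    have hN : N = f + 2 * ((N - f) / 2) := by omega
    have h2 : (2 * ℓ : ZMod (2 * ℓ)) = 0 := by exact_mod_cast ZMod.natCast_self (2 * ℓ)
    have hN' := congrArg (Int.cast : ℤ → ZMod (2 * ℓ)) hN
    push_cast at hN'
    rcases h with rfl | rfl
    · exact hN'
    · linear_combination hN' - h2

theorem encard_eq_add_two_mul (hℓ : 5 ≤ ℓ) (N : ℤ) (f : Fin 4 → ℤ) {a b : Fin 4} (hab : a ≠ b)
    (h : ∀ x, f x % 2 = N % 2 ↔ x = a ∨ x = b) :
    {x : Fin 4 × ZMod (2 * ℓ) | (N : ZMod (2 * ℓ)) = f x.1 + 2 * x.2}.encard = 4 := by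
  have hl := half_ne_zero hℓ
  rw [show {x : Fin 4 × ZMod (2 * ℓ) | (N : ZMod (2 * ℓ)) = f x.1 + 2 * x.2} =
    {x | x ∈ [(a, (((N - f a) / 2 : ℤ) : ZMod (2 * ℓ))), (a, ((N - f a) / 2 : ℤ) + (ℓ : ZMod (2 * ℓ))),
      (b, (((N - f b) / 2 : ℤ) : ZMod (2 * ℓ))), (b, ((N - f b) / 2 : ℤ) + (ℓ : ZMod (2 * ℓ)))]} by
    ext ⟨x, z⟩
    simp only [Set.mem_ofPred_eq, eq_add_two_mul_iff, h, List.mem_cons, Prod.mk.injEq,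
      List.not_mem_nil, or_false]
    constructor
    · rintro ⟨rfl | rfl, h1 | h1⟩ <;> simp [h1]
    · rintro (⟨rfl, h1⟩ | ⟨rfl, h1⟩ | ⟨rfl, h1⟩ | ⟨rfl, h1⟩) <;> simp [h1]]
  rw [encard_setOf_mem_list]
  · rfl
  · simp [hab, hl]

theorem encard_celPoint_mem_celLine (hℓ : 5 ≤ ℓ) (y : Fin 4 × ZMod (2 * ℓ)) :
    {x | celPoint ℓ x ∈ celLine ℓ y}.encard = 4 := by
  obtain ⟨j, i⟩ := y
  have hj : j ≠ j + 1 := by revert j; decide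
  have hs := spanS_ne_zero hℓ j
  have ht := spanT_ne_zero hℓ j
  rw [show {x | celPoint ℓ x ∈ celLine ℓ (j, i)} =
    {x | x ∈ [(j, i), (j, i + spanS j), (j + 1, i), (j + 1, i + spanT j)]} by
    ext ⟨a, k⟩
    simp only [Set.mem_ofPred_eq, celPoint_mem_celLine hℓ, List.mem_cons, Prod.mk.injEq,
      List.not_mem_nil, or_false]
    tauto]
  rw [encard_setOf_mem_list]
  · rfl
  · simp [hs, ht]

theorem encard_celLine_through_celPoint (hℓ : 5 ≤ ℓ) (x : Fin 4 × ZMod (2 * ℓ)) :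
    {y | celPoint ℓ x ∈ celLine ℓ y}.encard = 4 := by
  obtain ⟨a, k⟩ := x
  have ha : a ≠ a - 1 := by revert a; decide
  have hs := spanS_ne_zero hℓ a
  have ht := spanT_ne_zero hℓ (a - 1)
  rw [show {y | celPoint ℓ (a, k) ∈ celLine ℓ y} =
    {y | y ∈ [(a, k), (a, k - spanS a), (a - 1, k), (a - 1, k - spanT (a - 1))]} by
    ext ⟨j, i⟩
    simp only [Set.mem_ofPred_eq, celPoint_mem_celLine hℓ, List.mem_cons, Prod.mk.injEq,
      List.not_mem_nil, or_false, ← sub_eq_iff_eq_add]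
    constructor
    · rintro (⟨rfl, rfl | rfl⟩ | ⟨rfl, rfl | rfl⟩) <;> simp
    · rintro (⟨rfl, rfl⟩ | ⟨rfl, rfl⟩ | ⟨rfl, rfl⟩ | ⟨rfl, rfl⟩) <;> simp]
  rw [encard_setOf_mem_list]
  · rfl
  · simp [ha, hs, ht, eq_sub_iff_add_eq]

theorem isConfiguration_celestial (hℓ : 5 ≤ ℓ) :
    IsConfiguration extLines (2 * ℓ * 4) 4 (celestialPoints (basePoint ℓ))
      (celestialLines spanS (basePoint ℓ)) := by
  have : NeZero (2 * ℓ) := ⟨by omega⟩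
  rw [range_celPoint hℓ, range_celLine hℓ]
  have hcard : Nat.card (Fin 4 × ZMod (2 * ℓ)) = 2 * ℓ * 4 := by
    rw [Nat.card_prod, Nat.card_zmod, Nat.card_eq_fintype_card, Fintype.card_fin, mul_comm]
  exact isConfiguration_range (celLine_mem_extLines hℓ) (celPoint_injective hℓ)
    (celLine_injective hℓ) hcard hcard (encard_celPoint_mem_celLine hℓ)
    (encard_celLine_through_celPoint hℓ)

theorem isCelestial_basePoint (hℓ : 5 ≤ ℓ) :
    IsCelestial (2 * ℓ) spanS spanT (basePoint ℓ) where
  twist_int := by decide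
  rotate_eq j i := by
    have h1 := rotate_polar (ℓ := ℓ) (radius ℓ j) (offset j + 2 * i) 2
    rw [basePoint_eq_polar hℓ, basePoint_eq_polar hℓ,
      show offset j + 2 * (i + 1) = offset j + 2 * i + 2 by ring, ← h1]
    congr 1
    push_cast
    ring
  eq_iff := basePoint_eq_iff hℓ
  isConfiguration := isConfiguration_celestial hℓ
  mem_iff a k j i := by
    have ht : twist spanS spanT = 0 := by decide
    have hr : finRotate 4 j = j + 1 := by simp
    rw [celestialLine_eq hℓ, basePoint_mem_normalLine hℓ, ht, hr]
    simp

theorem isConfiguration_points_lines (hℓ : 5 ≤ ℓ) :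
    IsConfiguration extLines (10 * ℓ) 5 (points ℓ) (lines ℓ) := by
  have : NeZero (2 * ℓ) := ⟨by omega⟩
  rw [range_pointOf hℓ, range_lineFor hℓ]
  have hcard : Nat.card (Fin 4 × ZMod (2 * ℓ) ⊕ ZMod (2 * ℓ)) = 10 * ℓ := by
    rw [Nat.card_sum, Nat.card_prod, Nat.card_zmod, Nat.card_eq_fintype_card, Fintype.card_fin]
    ring
  refine isConfiguration_range ?_ (pointOf_injective hℓ) (lineFor_injective hℓ) hcard hcard ?_ ?_
  · rintro (y | k)
    · exact celLine_mem_extLines hℓ y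
    · exact centralLine_mem_extLines hℓ _
  · rintro (⟨j, i⟩ | n)
    · rw [encard_setOf_sum]
      change {x | celPoint ℓ x ∈ celLine ℓ (j, i)}.encard +
        {k : ZMod (2 * ℓ) | infPoint ℓ k.cast ∈ celLine ℓ (j, i)}.encard = _
      simp only [infPoint_mem_celLine hℓ]
      rw [encard_celPoint_mem_celLine hℓ, Set.ofPred_eq_eq_singleton, Set.encard_singleton]
      norm_num
    · rw [encard_setOf_sum]
      change {x : Fin 4 × ZMod (2 * ℓ) | celPoint ℓ (x.1, x.2) ∈ centralLine ℓ n.cast}.encard +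
        {k : ZMod (2 * ℓ) | infPoint ℓ k.cast ∈ centralLine ℓ n.cast}.encard = _
      simp only [infPoint_mem_centralLine_cast hℓ, celPoint_mem_centralLine hℓ]
      obtain ⟨N, rfl⟩ := ZMod.intCast_surjective n
      have h4 : {x : Fin 4 × ZMod (2 * ℓ) | (N : ZMod (2 * ℓ)) = offset x.1 + 2 * x.2}.encard =
          4 := by
        -- The offsets are 0, 1, 2, 1, so each parity selects two point classes.
        rcases Int.emod_two_eq_zero_or_one N with h | h
        · exact encard_eq_add_two_mul hℓ N offset (a := 0) (b := 2) (by decide)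
            (by rw [h]; decide)
        · exact encard_eq_add_two_mul hℓ N offset (a := 1) (b := 3) (by decide)
            (by rw [h]; decide)
      rw [h4, Set.ofPred_eq_eq_singleton, Set.encard_singleton]
      norm_num
  · rintro (⟨a, k⟩ | k)
    · rw [encard_setOf_sum]
      change {y | celPoint ℓ (a, k) ∈ celLine ℓ y}.encard +
        {n : ZMod (2 * ℓ) | celPoint ℓ (a, k) ∈ centralLine ℓ n.cast}.encard = _
      simp only [celPoint_mem_centralLine hℓ]
      rw [encard_celLine_through_celPoint hℓ, Set.ofPred_eq_eq_singleton, Set.encard_singleton]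
      norm_num
    · rw [encard_setOf_sum]
      change {y : Fin 4 × ZMod (2 * ℓ) | infPoint ℓ k.cast ∈ celLine ℓ (y.1, y.2)}.encard +
        {n : ZMod (2 * ℓ) | infPoint ℓ k.cast ∈ centralLine ℓ n.cast}.encard = _
      simp only [infPoint_mem_centralLine_cast hℓ, infPoint_mem_celLine hℓ,
        ← sub_eq_iff_eq_add (b := (ℓ : ZMod (2 * ℓ)))]
      obtain ⟨N, hN⟩ := ZMod.intCast_surjective (k - (ℓ : ZMod (2 * ℓ)))
      rw [← hN]
      have h4 : {x : Fin 4 × ZMod (2 * ℓ) | (N : ZMod (2 * ℓ)) =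
          ((offset x.1 + spanS x.1 : ℤ) : ZMod (2 * ℓ)) + 2 * x.2}.encard = 4 := by
        -- The normal angles start at 2, 5, 3, 4, so each parity selects two line classes.
        rcases Int.emod_two_eq_zero_or_one N with h | h
        · exact encard_eq_add_two_mul hℓ N (fun x => offset x + spanS x) (a := 0) (b := 3)
            (by decide) (by rw [h]; decide)
        · exact encard_eq_add_two_mul hℓ N (fun x => offset x + spanS x) (a := 1) (b := 2)
            (by decide) (by rw [h]; decide)
      rw [h4, Set.ofPred_eq_eq_singleton', Set.encard_singleton]
      norm_num

/-! ### Independent pencils -/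

theorem transform_mem_lineAtInfinity_of_mem_join (g : (Fin 3 → ℝ) ≃ₗ[ℝ] (Fin 3 → ℝ))
    {a b x : ExtPlane} (ha : transform g a ∈ lineAtInfinity) (hb : transform g b ∈ lineAtInfinity)
    (hx : x ∈ join a b) : transform g x ∈ lineAtInfinity := by
  induction a using Projectivization.ind with
  | h u hu =>
  induction b using Projectivization.ind with
  | h v hv =>
  induction x using Projectivization.ind with
  | h y hy =>
  rw [transform_mk, mk_mem_lineAtInfinity] at ha hb ⊢
  rw [mk_mem_join_mk] at hx
  obtain ⟨s, t, rfl⟩ := hx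
  simp [ha, hb]

theorem hasIndependentPencils_one_one (hℓ : 5 ≤ ℓ) (g : (Fin 3 → ℝ) ≃ₗ[ℝ] (Fin 3 → ℝ))
    (hg : IsSuitable g (points ℓ)) :
    HasIndependentPencils (project g (points ℓ)) (project g '' lines ℓ) 1 1 := by
  have hconf := isConfiguration_points_lines hℓ
  have h1 : (1 : ZMod (2 * ℓ)) ≠ 0 := by
    exact_mod_cast natCast_zmod_ne_zero (ℓ := ℓ) (c := 1) (by omega) (by omega)
  have h2 : (2 : ZMod (2 * ℓ)) ≠ 0 := by
    exact_mod_cast natCast_zmod_ne_zero (ℓ := ℓ) (c := 2) (by omega) (by omega)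
  have hl := half_ne_zero hℓ
  have hline : ∀ y, lineFor ℓ y ∈ lines ℓ := fun y => by
    rw [range_lineFor hℓ]
    exact ⟨y, rfl⟩
  by_cases hO : transform g (toExt 0) ∈ lineAtInfinity
  -- The line `(L_0)_0` has normal angle 2, so the central line at angle 2 meets it at the foot of
  -- the perpendicular from the origin.
  · have h02 : lineFor ℓ (Sum.inr 2) = centralLine ℓ 2 := by
      simpa [lineFor] using centralLine_cast hℓ 2
    have h00 : lineFor ℓ (Sum.inl (0, 0)) = normalLine ℓ (apothem ℓ 0) 2 := by
      have := celestialLine_eq hℓ 0 0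
      simpa [lineFor, celLine, offset, spanS] using this
    have hx : toExt (polar ℓ (apothem ℓ 0) 2) ∈ lineFor ℓ (Sum.inr 2) := by
      rw [h02, polar_mem_centralLine]
      simp [sinMul]
    have hx' : toExt (polar ℓ (apothem ℓ 0) 2) ∈ lineFor ℓ (Sum.inl (0, 0)) := by
      rw [h00, polar_mem_normalLine]
      simp
    refine hconf.hasIndependentPencils g (by norm_num) hg (hline _) (hline _)
      ((lineFor_injective hℓ).ne (by simp)) hx hx' ?_ ?_
    -- If the foot also went to infinity, so would the whole central line, including its point at
    -- infinity, which is a configuration point.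
    · intro hinf
      have hne : toExt 0 ≠ toExt (polar ℓ (apothem ℓ 0) 2) := by
        intro h
        have h4 : toExt 0 ∈ lineFor ℓ (Sum.inl (0, 0)) := h ▸ hx'
        rw [h00, normalLine, toExt_mem_lineOf] at h4
        have h5 : 0 < cosMul ℓ 2 := cosMul_pos (by norm_num) (by omega)
        simp [apothem] at h4
        exact h5.ne' h4
      have hmem : infPoint ℓ (2 : ZMod (2 * ℓ)).cast ∈ lineFor ℓ (Sum.inr 2) :=
        (infPoint_mem_centralLine_cast hℓ 2 2).2 rfl
      have hO2 : toExt 0 ∈ lineFor ℓ (Sum.inr 2) := h02 ▸ toExt_zero_mem_centralLine hℓ 2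
      rw [eq_join_of_mem (hconf.isLine (hline _)) hne hO2 hx] at hmem
      refine hg _ ?_ (transform_mem_lineAtInfinity_of_mem_join g hO hinf hmem)
      rw [range_pointOf hℓ]
      exact ⟨Sum.inr 2, rfl⟩
    · rw [range_pointOf hℓ]
      rintro _ ⟨⟨a, k⟩ | k, rfl⟩ ⟨h3, h4⟩
      -- The four celestial points on `(L_0)_0` have angles 0, 4, 1, 3, none congruent to 2 modulo
      -- 2ℓ. Its point at infinity has angle 2 + ℓ, also different from 2.
      · have h3 := (celPoint_mem_centralLine hℓ a k 2).1 h3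
        have h4 := (celPoint_mem_celLine hℓ a 0 k 0).1 h4
        rcases h4 with ⟨rfl, rfl | rfl⟩ | ⟨rfl, rfl | rfl⟩ <;>
          simp [offset, spanS, spanT] at h3
        · exact h2 h3
        · exact h2 (by linear_combination -h3)
        · exact h1 (by linear_combination h3)
        · exact h1 h3
      · have h3 := (infPoint_mem_centralLine_cast hℓ k 2).1 h3
        have h4 := (infPoint_mem_celLine hℓ 0 k 0).1 h4
        subst h3
        simp [offset, spanS] at h4
        exact hl h4
  -- The central lines at angles 0 and 1 have no common configuration point: each such point lies on
  -- only one central line.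
  · refine hconf.hasIndependentPencils g (by norm_num) hg (hline (Sum.inr 0)) (hline (Sum.inr 1))
      ((lineFor_injective hℓ).ne (by simpa using h1.symm)) (toExt_zero_mem_centralLine hℓ _)
      (toExt_zero_mem_centralLine hℓ _) hO ?_
    rw [range_pointOf hℓ]
    rintro _ ⟨⟨a, k⟩ | k, rfl⟩ ⟨h3, h4⟩
    · have h3 := (celPoint_mem_centralLine hℓ a k 0).1 h3
      have h4 := (celPoint_mem_centralLine hℓ a k 1).1 h4
      exact h1 (h4.trans h3.symm)
    · have h3 := (infPoint_mem_centralLine_cast hℓ k 0).1 h3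
      have h4 := (infPoint_mem_centralLine_cast hℓ k 1).1 h4
      exact h1 (h4.symm.trans h3)

end Index

end D4Config

theorem mainTheorem9 (ℓ : ℕ) (hℓ : 5 ≤ ℓ) :
    D4Config.IsCelestial (2 * ℓ) D4Config.spanS D4Config.spanT (D4Config.basePoint ℓ) ∧
    D4Config.IsConfiguration D4Config.extLines (10 * ℓ) 5
      (D4Config.points ℓ) (D4Config.lines ℓ) ∧
    (∀ g : (Fin 3 → ℝ) ≃ₗ[ℝ] (Fin 3 → ℝ), D4Config.IsSuitable g (D4Config.points ℓ) →
      D4Config.IsConfiguration D4Config.planeLines (10 * ℓ) 5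
        (D4Config.project g (D4Config.points ℓ))
        (D4Config.project g '' D4Config.lines ℓ) ∧
      D4Config.HasIndependentPencils
        (D4Config.project g (D4Config.points ℓ))
        (D4Config.project g '' D4Config.lines ℓ) 1 1) ∧
    (∃ g : (Fin 3 → ℝ) ≃ₗ[ℝ] (Fin 3 → ℝ), D4Config.IsSuitable g (D4Config.points ℓ) ∧
      ∀ p q : ℕ, D4Config.HasIndependentPencils
        (D4Config.project g (D4Config.points ℓ))
        (D4Config.project g '' D4Config.lines ℓ) p q → p ≤ 1 ∧ q ≤ 1) := by
  have hconf := D4Config.isConfiguration_points_lines hℓ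
  exact ⟨D4Config.isCelestial_basePoint hℓ, hconf,
    fun g hg => ⟨hconf.project g (by norm_num) hg,
      D4Config.hasIndependentPencils_one_one hℓ g hg⟩,
    hconf.exists_suitable_pencils_le_one (by norm_num)⟩
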